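/- Theorem (Noether's first theorem). Let $x^\mu$ ($\mu=0,\dots,n-1$) be coordinates on $\mathbb{R}^n$, $\phi^i$ ($i=1,\dots,m$) coordinates on $\mathbb{R}^m$, and let a local function be a smooth function of $x^\mu$, $\phi^i$ and finitely many of the derivative coordinates $\phi^i_I$, where $I$ runs over multi-indices. Let $\partial_\mu=\frac{\partial}{\partial x^\mu}+\phi^i_{I+\mu}\frac{\partial}{\partial \phi^i_I}$ be the total derivatives, $\partial_I$ their iterates, $\frac{\delta f}{\delta\phi^i}=\sum_I(-1)^{|I|}\partial_I\frac{\partial f}{\partial\phi^i_I}$ the Euler–Lagrange derivatives, and $\delta_Q=\partial_I Q^i\,\frac{\partial}{\partial\phi^i_I}$ the evolutionary vector field with characteristic $Q=(Q^i)$, where the $Q^i$ are local functions. Let $\Omega^p$ be the space of horizontal $p$-forms $\sum_{\mu_1<\dots<\mu_p}\omega_{\mu_1\dots\mu_p}dx^{\mu_1}\cdots dx^{\mu_p}$ with local functions as components ($\Omega^p=0$ for $p<0$), and $d_H=dx^\mu\partial_\mu$. Let $L$ be a local function. Write $f\approx0$ if the local function $f$ vanishes on the stationary surface $\{\partial_I\frac{\delta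 L}{\delta\phi^i}=0\ \text{for all } i,I\}$; a form or a differential operator is $\approx0$ if all its components, respectively coefficients, are. Assume the regularity condition that every $f\approx 0$ is a finite sum $f=k^{iI}\partial_I\frac{\delta L}{\delta\phi^i}$ with local functions $k^{iI}$. Assume that $L$ is an irreducible gauge theory with generating set $R^{\dagger i}_\alpha=R_\alpha^{\dagger iI}\partial_I$, $\alpha=1,\dots,r$ (possibly $r=0$), where the $R_\alpha^{\dagger iI}$ are local functions, finitely many of them nonzero; this means: * $R^{\dagger i}_\alpha[\frac{\delta L}{\delta\phi^i}]=0$ for every $\alpha$; * for no $\alpha$ are all $R_\alpha^{\dagger iI}\approx0$; * for differential operators $Z^{\dagger\alpha}=Z^{\dagger\alpha I}\partial_I$, if $Z^{\dagger\alpha}\circ R^{\dagger i}_\alpha\approx0$ for every $i$, then $Z^{\dagger\alpha}\approx0$ for every $\alpha$; * all differential operators $N^i=N^{iI}\partial_I$ with $N^i[\frac{\delta L}{\delta\phi^i}]=0$ are of the form $N^{i}=Z^{\dagger\alpha}\circ R^{\dagger i}_\alpha+M^{jJ\,iI}\big(\partial_J\tfrac{\delta L}{\delta\phi^j}\big)\partial_I$,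 where $Z^{\dagger\alpha}$ are differential operators and $M^{jJ\,iI}=-M^{iI\,jJ}$ are local functions, finitely many of them nonzero. Let $R^i_\alpha(f)=\sum_I(-1)^{|I|}\partial_I(R^{\dagger iI}_\alpha f)$ be the formal adjoints. Consider: * variational symmetries: characteristics $Q$ with $\delta_QL=\partial_\mu k^\mu$ for some local functions $k^\mu$; * trivial symmetries: $Q^i=R^i_\alpha(f^\alpha)+\sum(-1)^{|I|}\partial_I\big[M^{jJ\,iI}\partial_J\frac{\delta L}{\delta\phi^j}\big]$ with local functions $f^\alpha$ and $M^{jJ\,iI}=-M^{iI\,jJ}$, finitely many of the latter nonzero; * conserved currents: $j\in\Omega^{n-1}$ with $d_Hj\approx0$; * trivial currents: $j=t+d_H\eta+\delta^{n-1}_0C$ with $t\in\Omega^{n-1}$, $t\approx0$, $\eta\in\Omega^{n-2}$ and $C\in\mathbb{R}$ a constant. Then trivial symmetries are variational symmetries, trivial currents are conserved, every variational symmetry $Q$ has a conserved current $j$ with $d_Hj=Q^i\frac{\delta L}{\delta\phi^i}\,d^nx$, and there is a linear bijection $[Q]\mapsto[j]$ from variational symmetries modulo trivial ones onto conserved currents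 modulo trivial ones such that $[Q]\mapsto[j]$ whenever $d_Hj=Q^i\frac{\delta L}{\delta\phi^i}\,d^nx$. -/

import Mathlib

noncomputable section

namespace Jet

open scoped ContDiff

/-! ### Jet coordinates and local functions

The base is `ℝⁿ` with coordinates `x^μ`, the fibre is `ℝᵐ` with coordinates `φ^i`. -/

/-- Multi-indices `I = (I_0, …, I_{n-1})`; the derivative coordinate `φ^i_I` is indexed by `(i, I)`,
which builds in the symmetry of `φ^i_{μ₁…μ_k}` in its lower indices. -/
abbrev MultiIndex (n : ℕ) := Fin n →₀ ℕ

/-- The coordinates of the infinite jet space: `x^μ` (`Sum.inl μ`) and `φ^i_I` (`Sum.inr (i, I)`). -/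
abbrev Coord (n m : ℕ) := Fin n ⊕ (Fin m × MultiIndex n)

/-- Points of the infinite jet space. -/
abbrev JetSpace (n m : ℕ) := Coord n m → ℝ

/-- A function on the infinite jet space is local if it is a smooth function of finitely many of
the coordinates `x^μ, φ^i_I`, that is, a smooth function on some finite order jet space. -/
def IsLocal {n m : ℕ} (f : JetSpace n m → ℝ) : Prop :=
  ∃ (s : Finset (Coord n m)) (F : (s → ℝ) → ℝ),
    ContDiff ℝ ∞ F ∧ ∀ z : JetSpace n m, f z = F (fun c => z c)

theorem IsLocal.enlarge {n m : ℕ} {f : JetSpace n m → ℝ} {s : Finset (Coord n m)}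
    {F : (s → ℝ) → ℝ} (hF : ContDiff ℝ ∞ F) (hf : ∀ z : JetSpace n m, f z = F (fun c => z c))
    {t : Finset (Coord n m)} (hst : s ⊆ t) :
    ∃ G : (t → ℝ) → ℝ, ContDiff ℝ ∞ G ∧ ∀ z : JetSpace n m, f z = G (fun c => z c) := by
  refine ⟨fun y => F (fun c => y ⟨c.1, hst c.2⟩), ?_, fun z => hf z⟩
  exact hF.comp (contDiff_pi.2 fun c => contDiff_apply ℝ ℝ (⟨c.1, hst c.2⟩ : t))

theorem IsLocal.common {n m : ℕ} {f g : JetSpace n m → ℝ} (hf : IsLocal f) (hg : IsLocal g) :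
    ∃ (s : Finset (Coord n m)) (F G : (s → ℝ) → ℝ), ContDiff ℝ ∞ F ∧ ContDiff ℝ ∞ G ∧
      (∀ z : JetSpace n m, f z = F (fun c => z c)) ∧
      (∀ z : JetSpace n m, g z = G (fun c => z c)) := by
  obtain ⟨s, F, hF, hfF⟩ := hf
  obtain ⟨t, G, hG, hgG⟩ := hg
  obtain ⟨F', hF', h1⟩ := IsLocal.enlarge hF hfF (Finset.subset_union_left (s₂ := t))
  obtain ⟨G', hG', h2⟩ := IsLocal.enlarge hG hgG (Finset.subset_union_right (s₁ := s))
  exact ⟨s ∪ t, F', G', hF', hG', h1, h2⟩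

/-- The local functions, as a subalgebra of all functions on the jet space. -/
def localSubalgebra (n m : ℕ) : Subalgebra ℝ (JetSpace n m → ℝ) where
  carrier := {f | IsLocal f}
  mul_mem' := by
    intro f g hf hg
    obtain ⟨s, F, G, hF, hG, h1, h2⟩ := IsLocal.common hf hg
    exact ⟨s, fun y => F y * G y, hF.mul hG, fun z => by simp [h1 z, h2 z]⟩
  add_mem' := by
    intro f g hf hg
    obtain ⟨s, F, G, hF, hG, h1, h2⟩ := IsLocal.common hf hg
    exact ⟨s, fun y => F y + G y, hF.add hG, fun z => by simp [h1 z, h2 z]⟩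
  algebraMap_mem' := fun r => ⟨∅, fun _ => r, contDiff_const, fun _ => rfl⟩

/-- The algebra of local functions `f[x, φ]`. -/
def LocalFn (n m : ℕ) : Type := localSubalgebra n m

instance LocalFn.instCommRing (n m : ℕ) : CommRing (LocalFn n m) :=
  inferInstanceAs (CommRing (localSubalgebra n m))

instance LocalFn.instAlgebra (n m : ℕ) : Algebra ℝ (LocalFn n m) :=
  inferInstanceAs (Algebra ℝ (localSubalgebra n m))

/-- The value of a local function at a point of the jet space. -/
def LocalFn.eval {n m : ℕ} (f : LocalFn n m) (z : JetSpace n m) : ℝ := f.1 z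

theorem LocalFn.eval_add {n m : ℕ} (f g : LocalFn n m) (z : JetSpace n m) :
    (f + g).eval z = f.eval z + g.eval z := rfl

theorem LocalFn.eval_smul {n m : ℕ} (a : ℝ) (f : LocalFn n m) (z : JetSpace n m) :
    (a • f).eval z = a * f.eval z := rfl

/-- A coordinate, as a local function. -/
def coord {n m : ℕ} (c : Coord n m) : LocalFn n m :=
  ⟨fun z => z c, {c}, fun y => y ⟨c, Finset.mem_singleton_self c⟩,
    contDiff_apply ℝ ℝ (⟨c, Finset.mem_singleton_self c⟩ : ({c} : Finset (Coord n m))),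
    fun _ => rfl⟩

/-! ### Partial derivatives -/

/-- The partial derivative with respect to the coordinate `c`, on functions on the jet space. -/
def rawPartial {n m : ℕ} (c : Coord n m) (f : JetSpace n m → ℝ) (z : JetSpace n m) : ℝ :=
  deriv (fun t : ℝ => f (Function.update z c t)) (z c)

theorem restrict_update_of_mem {n m : ℕ} {s : Finset (Coord n m)} {c : Coord n m} (hc : c ∈ s)
    (z : JetSpace n m) (t : ℝ) :
    (fun d : s => Function.update z c t d) = Function.update (fun d : s => z d) ⟨c, hc⟩ t := by
  funext d
  by_cases h : d = ⟨c, hc⟩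
  · subst h; simp
  · have h' : (d : Coord n m) ≠ c := fun e => h (Subtype.ext e)
    simp [h, h']

theorem restrict_update_of_notMem {n m : ℕ} {s : Finset (Coord n m)} {c : Coord n m}
    (hc : c ∉ s) (z : JetSpace n m) (t : ℝ) :
    (fun d : s => Function.update z c t d) = fun d : s => z d := by
  funext d
  have h' : (d : Coord n m) ≠ c := fun e => hc (e ▸ d.2)
  simp [h']

theorem hasDerivAt_of_mem {n m : ℕ} {f : JetSpace n m → ℝ} {s : Finset (Coord n m)}
    {F : (s → ℝ) → ℝ} (hF : ContDiff ℝ ∞ F) (hf : ∀ z : JetSpace n m, f z = F (fun c => z c))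
    {c : Coord n m} (hc : c ∈ s) (z : JetSpace n m) :
    HasDerivAt (fun t : ℝ => f (Function.update z c t))
      (fderiv ℝ F (fun d : s => z d) (Pi.single ⟨c, hc⟩ 1)) (z c) := by
  have h1 : (fun t : ℝ => f (Function.update z c t)) =
      F ∘ fun t : ℝ => Function.update (fun d : s => z d) ⟨c, hc⟩ t := by
    funext t
    simp only [Function.comp]
    rw [hf, restrict_update_of_mem hc]
  rw [h1]
  have h2 : Function.update (fun d : s => z d) ⟨c, hc⟩ (z c) = fun d : s => z d := by
    exact Function.update_eq_self (⟨c, hc⟩ : s) (fun d : s => z d)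
  have h3 : HasFDerivAt F (fderiv ℝ F (fun d : s => z d))
      (Function.update (fun d : s => z d) ⟨c, hc⟩ (z c)) := by
    rw [h2]
    exact ((hF.differentiable (by simp)) _).hasFDerivAt
  exact h3.comp_hasDerivAt (z c) (hasDerivAt_update (fun d : s => z d) ⟨c, hc⟩ (z c))

theorem rawPartial_of_notMem {n m : ℕ} {f : JetSpace n m → ℝ} {s : Finset (Coord n m)}
    {F : (s → ℝ) → ℝ} (hf : ∀ z : JetSpace n m, f z = F (fun c => z c))
    {c : Coord n m} (hc : c ∉ s) : rawPartial c f = 0 := by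
  funext z
  unfold rawPartial
  have : (fun t : ℝ => f (Function.update z c t)) = fun _ => F (fun d : s => z d) := by
    funext t
    rw [hf, restrict_update_of_notMem hc]
  rw [this]
  simp

theorem IsLocal.differentiableAt {n m : ℕ} {f : JetSpace n m → ℝ} (hf : IsLocal f)
    (c : Coord n m) (z : JetSpace n m) :
    DifferentiableAt ℝ (fun t : ℝ => f (Function.update z c t)) (z c) := by
  obtain ⟨s, F, hF, h⟩ := hf
  obtain ⟨G, hG, h'⟩ := IsLocal.enlarge hF h (Finset.subset_insert c s)
  exact (hasDerivAt_of_mem hG h' (Finset.mem_insert_self c s) z).differentiableAt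

theorem IsLocal.rawPartial {n m : ℕ} {f : JetSpace n m → ℝ} (hf : IsLocal f)
    (c : Coord n m) : IsLocal (Jet.rawPartial c f) := by
  obtain ⟨s, F, hF, h⟩ := hf
  by_cases hc : c ∈ s
  · refine ⟨s, fun y => fderiv ℝ F y (Pi.single ⟨c, hc⟩ 1), ?_, fun z => ?_⟩
    · exact (hF.fderiv_right (m := ∞) (by simp)).clm_apply contDiff_const
    · have := (hasDerivAt_of_mem hF h hc z).deriv
      unfold Jet.rawPartial
      convert this
  · rw [rawPartial_of_notMem h hc]
    exact (localSubalgebra n m).zero_mem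

/-- The partial derivative `∂/∂c` of local functions, for a jet coordinate `c`. -/
def pderiv {n m : ℕ} (c : Coord n m) : Module.End ℝ (LocalFn n m) where
  toFun f := ⟨rawPartial c f.1, IsLocal.rawPartial f.2 c⟩
  map_add' f g := by
    apply Subtype.ext
    funext z
    exact deriv_fun_add (IsLocal.differentiableAt f.2 c z) (IsLocal.differentiableAt g.2 c z)
  map_smul' a f := by
    apply Subtype.ext
    funext z
    exact deriv_const_mul a (IsLocal.differentiableAt f.2 c z)

/-- A local function depends on finitely many of the `φ^i_I`. -/
theorem finite_support_pderiv {n m : ℕ} (f : LocalFn n m) :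
    (Function.support fun p : Fin m × MultiIndex n => pderiv (Sum.inr p) f).Finite := by
  obtain ⟨f, s, F, hF, h⟩ := f
  refine Set.Finite.subset (s := Sum.inr ⁻¹' (s : Set (Coord n m)))
    (s.finite_toSet.preimage Sum.inr_injective.injOn) ?_
  intro p hp
  by_contra hps
  apply hp
  apply Subtype.ext
  exact rawPartial_of_notMem h hps

theorem finite_support_of_pderiv {n m : ℕ} (f : LocalFn n m)
    (T : Fin m × MultiIndex n → Module.End ℝ (LocalFn n m)) :
    (Function.support fun p => T p (pderiv (Sum.inr p) f)).Finite := by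
  refine (finite_support_pderiv f).subset fun p hp hp0 => hp ?_
  simp only at hp0
  simp [hp0]

/-! ### Total derivatives, Euler-Lagrange derivatives, evolutionary vector fields -/

/-- The linear map `f ↦ ∑_{(i, I)} T_{(i, I)} (∂f/∂φ^i_I)`; the sum is finite for each `f`. -/
def sumPartials {n m : ℕ} (T : Fin m × MultiIndex n → Module.End ℝ (LocalFn n m)) :
    Module.End ℝ (LocalFn n m) where
  toFun f := ∑ᶠ p, T p (pderiv (Sum.inr p) f)
  map_add' f g := by
    simp only [map_add]
    exact finsum_add_distrib (finite_support_of_pderiv f T) (finite_support_of_pderiv g T)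
  map_smul' a f := by
    simp only [map_smul, RingHom.id_apply]
    exact (smul_finsum' a (finite_support_of_pderiv f T)).symm

/-- The total derivative `∂_μ = ∂/∂x^μ + ∑ φ^i_{I+μ} ∂/∂φ^i_I`. -/
def totalDeriv {n m : ℕ} (μ : Fin n) : Module.End ℝ (LocalFn n m) :=
  pderiv (Sum.inl μ) +
    sumPartials fun p => LinearMap.mulLeft ℝ (coord (Sum.inr (p.1, p.2 + Finsupp.single μ 1)))

/-- `T_0 ^ I_0 * T_1 ^ I_1 * ⋯`. -/
def multiPow {n : ℕ} {A : Type*} [Monoid A] (T : Fin n → A) (I : MultiIndex n) : A :=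
  ((List.finRange n).map fun μ => T μ ^ I μ).prod

/-- The iterated total derivative `∂_I`. -/
def totalD {n m : ℕ} (I : MultiIndex n) : Module.End ℝ (LocalFn n m) :=
  multiPow totalDeriv I

/-- The Euler-Lagrange derivative `δf/δφ^i = ∑_I (-1)^{|I|} ∂_I (∂f/∂φ^i_I)`. -/
def eulerLagrange {n m : ℕ} (i : Fin m) : Module.End ℝ (LocalFn n m) :=
  sumPartials fun p => if p.1 = i then (-1 : ℝ) ^ p.2.degree • totalD p.2 else 0

/-- The evolutionary vector field `δ_Q f = ∑ ∂_I Q^i ∂f/∂φ^i_I` of a characteristic `Q`. -/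
def evolutionary {n m : ℕ} (Q : Fin m → LocalFn n m) : Module.End ℝ (LocalFn n m) :=
  sumPartials fun p => LinearMap.mulLeft ℝ (totalD p.2 (Q p.1))

/-! ### Total differential operators -/

/-- A total differential operator `∑_I N^I ∂_I` (a finite sum), given by its coefficients. -/
abbrev DiffOp (n m : ℕ) := MultiIndex n →₀ LocalFn n m

/-- `N[f] = ∑_I N^I ∂_I f`. -/
def DiffOp.apply {n m : ℕ} (N : DiffOp n m) (f : LocalFn n m) : LocalFn n m :=
  N.sum fun I a => a * totalD I f

/-- The formal adjoint: `N† [f] = ∑_I (-1)^{|I|} ∂_I (N^I f)`. -/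
def DiffOp.adjointApply {n m : ℕ} (N : DiffOp n m) (f : LocalFn n m) : LocalFn n m :=
  N.sum fun I a => (-1 : ℝ) ^ I.degree • totalD I (a * f)

/-- The coefficients of `∂_μ ∘ N = ∑_I (∂_μ N^I) ∂_I + ∑_I N^I ∂_{I+μ}`. -/
def DiffOp.leftD {n m : ℕ} (μ : Fin n) : Module.End ℝ (DiffOp n m) :=
  Finsupp.mapRange.linearMap (totalDeriv μ) +
    Finsupp.lmapDomain (LocalFn n m) ℝ (fun I : MultiIndex n => I + Finsupp.single μ 1)

/-- The coefficients of the composition `Z ∘ N = ∑_I Z^I (∂_I ∘ N)`. -/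
def DiffOp.comp {n m : ℕ} (Z N : DiffOp n m) : DiffOp n m :=
  Z.sum fun I a => a • multiPow DiffOp.leftD I N

/-! ### Stationary surface, Noether identities, irreducible gauge theories -/

/-- The stationary surface: all `∂_I (δL/δφ^i)` vanish. -/
def stationarySurface {n m : ℕ} (L : LocalFn n m) : Set (JetSpace n m) :=
  {z | ∀ (i : Fin m) (I : MultiIndex n), (totalD I (eulerLagrange i L)).eval z = 0}

/-- `f ≈ 0`: the local function `f` vanishes on the stationary surface. -/
def WeaklyZero {n m : ℕ} (L f : LocalFn n m) : Prop :=
  ∀ z ∈ stationarySurface L, f.eval z = 0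

/-- The regularity assumption on the equations of motion: a local function that vanishes on the
stationary surface is a combination of the functions `∂_I (δL/δφ^i)` that define it. -/
def IsRegular {n m : ℕ} (L : LocalFn n m) : Prop :=
  ∀ f : LocalFn n m, WeaklyZero L f →
    ∃ k : Fin m → DiffOp n m, f = ∑ i, (k i).apply (eulerLagrange i L)

/-- `N^i[δL/δφ^i] = 0`. -/
def IsNoetherIdentity {n m : ℕ} (L : LocalFn n m) (N : Fin m → DiffOp n m) : Prop :=
  ∑ i, (N i).apply (eulerLagrange i L) = 0

/-- Arrays `M^{j(J) i(I)}` of local functions, finitely many of them nonzero. -/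
abbrev EomArray (n m : ℕ) :=
  (Fin m × MultiIndex n) × (Fin m × MultiIndex n) →₀ LocalFn n m

/-- Antisymmetry under exchange of the pairs `(j, J)` and `(i, I)`. -/
def EomArray.IsAntisymm {n m : ℕ} (M : EomArray n m) : Prop :=
  ∀ a b, M (a, b) = -M (b, a)

/-- The operator `∑ M^{j(J) i(I)} ∂_J (δL/δφ^j) ∂_I`, for each fixed `i`. -/
def onShellOp {n m : ℕ} (L : LocalFn n m) (M : EomArray n m) (i : Fin m) : DiffOp n m :=
  M.sum fun p a =>
    if p.2.1 = i then Finsupp.single p.2.2 (a * totalD p.1.2 (eulerLagrange p.1.1 L)) else 0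

/-- `L` with the Noether operators `R_α^{† i}` is an irreducible gauge theory. The case `r = 0` of
no nontrivial Noether identities is included. -/
structure IsIrreducibleGaugeTheory {n m r : ℕ} (L : LocalFn n m)
    (R : Fin r → Fin m → DiffOp n m) : Prop where
  noether : ∀ α, IsNoetherIdentity L (R α)
  nontrivial : ∀ α, ¬ ∀ i I, WeaklyZero L (R α i I)
  irreducible : ∀ Z : Fin r → DiffOp n m,
    (∀ i I, WeaklyZero L ((∑ α, (Z α).comp (R α i)) I)) → ∀ α I, WeaklyZero L (Z α I)
  generating : ∀ N : Fin m → DiffOp n m, IsNoetherIdentity L N →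
    ∃ (Z : Fin r → DiffOp n m) (M : EomArray n m), M.IsAntisymm ∧
      ∀ i, N i = ∑ α, (Z α).comp (R α i) + onShellOp L M i

/-! ### Linearity facts used to form quotient spaces -/

theorem evolutionary_add {n m : ℕ} (Q Q' : Fin m → LocalFn n m) (f : LocalFn n m) :
    evolutionary (Q + Q') f = evolutionary Q f + evolutionary Q' f := by
  have h := finsum_add_distrib
    (finite_support_of_pderiv f fun p => LinearMap.mulLeft ℝ (totalD p.2 (Q p.1)))
    (finite_support_of_pderiv f fun p => LinearMap.mulLeft ℝ (totalD p.2 (Q' p.1)))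
  simpa [evolutionary, sumPartials, add_mul] using h

theorem evolutionary_smul {n m : ℕ} (a : ℝ) (Q : Fin m → LocalFn n m) (f : LocalFn n m) :
    evolutionary (a • Q) f = a • evolutionary Q f := by
  have h := smul_finsum' a
    (finite_support_of_pderiv f fun p => LinearMap.mulLeft ℝ (totalD p.2 (Q p.1)))
  simpa [evolutionary, sumPartials] using h.symm

theorem DiffOp.adjointApply_add_left {n m : ℕ} (N N' : DiffOp n m) (f : LocalFn n m) :
    (N + N').adjointApply f = N.adjointApply f + N'.adjointApply f := by
  exact Finsupp.sum_add_index' (by simp) (by intros; simp [add_mul])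

theorem DiffOp.adjointApply_smul_left {n m : ℕ} (a : ℝ) (N : DiffOp n m) (f : LocalFn n m) :
    (a • N).adjointApply f = a • N.adjointApply f := by
  unfold DiffOp.adjointApply
  rw [Finsupp.sum_smul_index' (by simp), Finsupp.smul_sum]
  refine Finsupp.sum_congr fun I _ => ?_
  rw [smul_mul_assoc, map_smul, smul_comm]

theorem DiffOp.adjointApply_add {n m : ℕ} (N : DiffOp n m) (f g : LocalFn n m) :
    N.adjointApply (f + g) = N.adjointApply f + N.adjointApply g := by
  simp [DiffOp.adjointApply, mul_add, Finsupp.sum_add]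

theorem DiffOp.adjointApply_smul {n m : ℕ} (a : ℝ) (N : DiffOp n m) (f : LocalFn n m) :
    N.adjointApply (a • f) = a • N.adjointApply f := by
  unfold DiffOp.adjointApply
  rw [Finsupp.smul_sum]
  refine Finsupp.sum_congr fun I _ => ?_
  rw [mul_smul_comm, map_smul, smul_comm]

theorem onShellOp_add {n m : ℕ} (L : LocalFn n m) (M M' : EomArray n m) (i : Fin m) :
    onShellOp L (M + M') i = onShellOp L M i + onShellOp L M' i := by
  refine Finsupp.sum_add_index' (fun p => ?_) (fun p a b => ?_)
  · simp
  · split_ifs <;> simp [add_mul]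

theorem onShellOp_smul {n m : ℕ} (a : ℝ) (L : LocalFn n m) (M : EomArray n m) (i : Fin m) :
    onShellOp L (a • M) i = a • onShellOp L M i := by
  unfold onShellOp
  rw [Finsupp.sum_smul_index' (by simp), Finsupp.smul_sum]
  refine Finsupp.sum_congr fun p _ => ?_
  split_ifs
  · rw [smul_mul_assoc, Finsupp.smul_single]
  · simp

/-! ### Symmetries -/

/-- Variational symmetries: characteristics `Q` with `δ_Q L = ∂_μ k^μ` for some local functions
`k^μ`. -/
def variationalSymmetries {n m : ℕ} (L : LocalFn n m) : Submodule ℝ (Fin m → LocalFn n m) where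
  carrier := {Q | ∃ k : Fin n → LocalFn n m, evolutionary Q L = ∑ μ, totalDeriv μ (k μ)}
  add_mem' := by
    rintro Q Q' ⟨k, hk⟩ ⟨k', hk'⟩
    exact ⟨k + k', by simp [evolutionary_add, hk, hk', Finset.sum_add_distrib]⟩
  zero_mem' := ⟨0, by
    have := evolutionary_smul (0 : ℝ) (0 : Fin m → LocalFn n m) L
    rw [zero_smul, zero_smul] at this
    simp [this]⟩
  smul_mem' := by
    rintro a Q ⟨k, hk⟩
    exact ⟨a • k, by simp [evolutionary_smul, hk, Finset.smul_sum]⟩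

/-- Trivial symmetries:
`Q^i = R^i_α(f^α) + ∑ (-1)^{|I|} ∂_I [M^{j(J) i(I)} ∂_J (δL/δφ^j)]` with local functions `f^α` and an
antisymmetric array `M`, where `R^i_α` is the formal adjoint of the Noether operator. -/
def trivialSymmetries {n m r : ℕ} (L : LocalFn n m) (R : Fin r → Fin m → DiffOp n m) :
    Submodule ℝ (Fin m → LocalFn n m) where
  carrier := {Q | ∃ (f : Fin r → LocalFn n m) (M : EomArray n m), M.IsAntisymm ∧
    ∀ i, Q i = ∑ α, (R α i).adjointApply (f α) + (onShellOp L M i).adjointApply 1}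
  add_mem' := by
    rintro Q Q' ⟨f, M, hM, h⟩ ⟨f', M', hM', h'⟩
    refine ⟨f + f', M + M', fun a b => ?_, fun i => ?_⟩
    · rw [Finsupp.add_apply, Finsupp.add_apply, hM a b, hM' a b, neg_add]
    · simp only [Pi.add_apply, h, h', DiffOp.adjointApply_add, onShellOp_add,
        DiffOp.adjointApply_add_left, Finset.sum_add_distrib]
      abel
  zero_mem' := by
    refine ⟨0, 0, fun a b => by simp, fun i => ?_⟩
    simp [DiffOp.adjointApply, onShellOp]
  smul_mem' := by
    rintro a Q ⟨f, M, hM, h⟩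
    refine ⟨a • f, a • M, fun b c => ?_, fun i => ?_⟩
    · rw [Finsupp.smul_apply, Finsupp.smul_apply, hM b c, smul_neg]
    · simp only [Pi.smul_apply, h, DiffOp.adjointApply_smul, onShellOp_smul,
        DiffOp.adjointApply_smul_left, smul_add, Finset.smul_sum]

/-! ### Horizontal forms and currents -/

/-- Horizontal forms `∑_S θ_S dx^S` of mixed degree, where for `S = {μ₁ < ⋯ < μ_p}` the monomial
`dx^S` is `dx^{μ₁} ⋯ dx^{μ_p}`. -/
abbrev HForm (n m : ℕ) := Finset (Fin n) → LocalFn n m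

/-- Horizontal forms of degree `p` (only `0` if `p < 0`). -/
def HForm.degree (n m : ℕ) (p : ℤ) : Submodule ℝ (HForm n m) where
  carrier := {θ | ∀ S : Finset (Fin n), (S.card : ℤ) ≠ p → θ S = 0}
  add_mem' := fun h h' S hS => by simp [h S hS, h' S hS]
  zero_mem' := fun _ _ => rfl
  smul_mem' := fun a θ h S hS => by simp [h S hS]

/-- The horizontal differential `d_H θ = dx^μ ∂_μ θ`; the sign is that of
`dx^μ dx^{S \ μ} = ± dx^S`. -/
def dH {n m : ℕ} : Module.End ℝ (HForm n m) where
  toFun θ S := ∑ μ ∈ S, (-1 : ℝ) ^ (S.filter (· < μ)).card • totalDeriv μ (θ (S.erase μ))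
  map_add' θ η := by
    funext S
    simp [Finset.sum_add_distrib]
  map_smul' a θ := by
    funext S
    simp only [Pi.smul_apply, map_smul, RingHom.id_apply, Finset.smul_sum]
    exact Finset.sum_congr rfl fun μ _ => smul_comm _ _ _

/-- The top form `f dⁿx`. -/
def topForm {n m : ℕ} (f : LocalFn n m) : HForm n m := Pi.single Finset.univ f

/-- The constant 0-form `C`. -/
def constForm {n m : ℕ} (C : ℝ) : HForm n m := Pi.single ∅ (algebraMap ℝ (LocalFn n m) C)

/-- `θ ≈ 0` for horizontal forms: all components vanish on the stationary surface. -/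
def HForm.WeaklyZero {n m : ℕ} (L : LocalFn n m) (θ : HForm n m) : Prop :=
  ∀ S, Jet.WeaklyZero L (θ S)

theorem HForm.WeaklyZero.add {n m : ℕ} {L : LocalFn n m} {θ η : HForm n m}
    (h : HForm.WeaklyZero L θ) (h' : HForm.WeaklyZero L η) : HForm.WeaklyZero L (θ + η) := by
  intro S z hz
  rw [Pi.add_apply, LocalFn.eval_add, h S z hz, h' S z hz, add_zero]

theorem HForm.WeaklyZero.smul {n m : ℕ} {L : LocalFn n m} {θ : HForm n m} (a : ℝ)
    (h : HForm.WeaklyZero L θ) : HForm.WeaklyZero L (a • θ) := by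
  intro S z hz
  rw [Pi.smul_apply, LocalFn.eval_smul, h S z hz, mul_zero]

/-- Conserved currents: `(n-1)`-forms `j` with `d_H j ≈ 0`. -/
def conservedCurrents {n m : ℕ} (L : LocalFn n m) : Submodule ℝ (HForm n m) where
  carrier := {j | j ∈ HForm.degree n m ((n : ℤ) - 1) ∧ HForm.WeaklyZero L (dH j)}
  add_mem' := fun h h' => ⟨add_mem h.1 h'.1, by rw [map_add]; exact h.2.add h'.2⟩
  zero_mem' := ⟨zero_mem _, by rw [map_zero]; exact fun S z _ => rfl⟩
  smul_mem' := fun a j h => ⟨Submodule.smul_mem _ a h.1, by rw [map_smul]; exact h.2.smul a⟩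

/-- Trivial currents: `t + d_H η + C` with an `(n-1)`-form `t ≈ 0`, an `(n-2)`-form `η`, and a
constant `C` that may be nonzero only if `n = 1`. -/
def trivialCurrents {n m : ℕ} (L : LocalFn n m) : Submodule ℝ (HForm n m) where
  carrier := {j | ∃ (t η : HForm n m) (C : ℝ), t ∈ HForm.degree n m ((n : ℤ) - 1) ∧
    HForm.WeaklyZero L t ∧ η ∈ HForm.degree n m ((n : ℤ) - 2) ∧ (n ≠ 1 → C = 0) ∧
    j = t + dH η + constForm C}
  add_mem' := by
    rintro _ _ ⟨t, η, C, h1, h2, h3, h4, rfl⟩ ⟨t', η', C', h1', h2', h3', h4', rfl⟩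
    refine ⟨t + t', η + η', C + C', add_mem h1 h1', h2.add h2', add_mem h3 h3',
      fun hn => by rw [h4 hn, h4' hn, add_zero], ?_⟩
    simp only [constForm, map_add, Pi.single_add]
    abel
  zero_mem' := ⟨0, 0, 0, zero_mem _, fun S z _ => rfl, zero_mem _, fun _ => rfl, by
    simp [constForm]⟩
  smul_mem' := by
    rintro a _ ⟨t, η, C, h1, h2, h3, h4, rfl⟩
    refine ⟨a • t, a • η, a • C, Submodule.smul_mem _ a h1, h2.smul a, Submodule.smul_mem _ a h3,
      fun hn => by rw [h4 hn, smul_zero], ?_⟩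
    simp only [constForm, map_smul, smul_add, Algebra.algebraMap_eq_smul_one, Pi.single_smul,
      smul_assoc]

/-- `j` is a Noether current of `Q`: `d_H j = Q^i (δL/δφ^i) dⁿx`. -/
def IsNoetherCurrent {n m : ℕ} (L : LocalFn n m) (Q : Fin m → LocalFn n m) (j : HForm n m) :
    Prop :=
  dH j = topForm (∑ i, Q i * eulerLagrange i L)

/-- Variational symmetries modulo trivial ones. -/
abbrev SymmetryClasses {n m r : ℕ} (L : LocalFn n m) (R : Fin r → Fin m → DiffOp n m) :=
  variationalSymmetries L ⧸ (trivialSymmetries L R).submoduleOf (variationalSymmetries L)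

/-- Conserved currents modulo trivial ones. -/
abbrev CurrentClasses {n m : ℕ} (L : LocalFn n m) :=
  conservedCurrents L ⧸ (trivialCurrents L).submoduleOf (conservedCurrents L)

end Jet

end

/-!
Write `E_i = δL/δφ^i`. By integration by parts, `δ_Q L` and `Q^i E_i` differ by a total divergence, so
`Q` is a variational symmetry exactly if `Q^i E_i` is a divergence `∂_μ j^μ`
(`Jet.mem_variationalSymmetries_iff`). It is trivial exactly if `j` can be chosen to vanish on the
stationary surface (`Jet.mem_trivialSymmetries_iff`): if `j^μ = k^{μ i}[E_i]`, the operators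
`Q^i - ∂_μ ∘ k^{μ i}` form a Noether identity, and the adjoint of its expansion in the generating set,
applied to `1`, is the expansion of `Q^i` as a trivial symmetry. Conversely, regularity gives
`d_H j = k^i[E_i] dⁿx` for every conserved current `j`, and integration by parts turns the right-hand
side into `k^{i†}(1) E_i dⁿx` up to the differential of a weakly vanishing current
(`Jet.exists_isNoetherCurrent_sub`). The relation `d_H j = Q^i E_i dⁿx` between `Q` and `j` therefore
descends to a bijection of the quotients, provided that two currents with the same differential
differ by a trivial one.

This last point is the algebraic Poincaré lemma in degree `n - 1` (`Jet.exists_eq_dH_add_const`),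
which is proved in terms of vectors `j^μ` by induction on the set `A` of directions along which the
divergence is taken (`Jet.exists_antisymm_of_divergence_eq_zero`). When a direction `a` is added to
`A`, the equation says that `∂_a j^a` is a divergence along `A`. The Euler operators along `A`, with the
derivatives of `φ` in the other directions treated as separate fields, annihilate divergences and
commute with `∂_a` up to a shift, and a local function has finite order, so they annihilate `j^a`
(`Jet.partialEuler_eq_zero_of_totalDeriv`). A function annihilated by them is a divergence
(`Jet.mem_divergences_of_partialEuler`): the homotopy `f ↦ ∫₀¹ f(x, tφ) dt` commutes with total
derivatives, and integrating `f(x, φ) - f(x, 0)` by parts leaves only Euler operators. Thus `j^a` can be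
removed by an antisymmetric array, and the induction hypothesis applies to what remains.
-/

open scoped ContDiff

namespace Jet

/-! ### Smoothness of parametric integrals -/

section ParametricIntegral

variable {X : Type} [NormedAddCommGroup X] [NormedSpace ℝ X] [ProperSpace X]

theorem hasFDerivAt_integral_param {E : Type} [NormedAddCommGroup E] [NormedSpace ℝ E]
    {F : X × ℝ → E} (hF : ContDiff ℝ 1 F) (x : X) :
    HasFDerivAt (fun x => ∫ t in (0 : ℝ)..1, F (x, t))
      (∫ t in (0 : ℝ)..1, (fderiv ℝ F (x, t)).comp (ContinuousLinearMap.inl ℝ X ℝ)) x := by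
  have hc : Continuous fun q : X × ℝ =>
      (fderiv ℝ F q).comp (ContinuousLinearMap.inl ℝ X ℝ) :=
    (hF.continuous_fderiv (by simp)).clm_comp continuous_const
  obtain ⟨C, hC⟩ := ((isCompact_closedBall x 1).prod
    (isCompact_Icc (a := (0 : ℝ)) (b := 1))).exists_bound_of_continuousOn hc.continuousOn
  have hcx : ∀ y : X, Continuous fun t : ℝ => F (y, t) := fun y =>
    hF.continuous.comp (by fun_prop)
  refine intervalIntegral.hasFDerivAt_integral_of_dominated_of_fderiv_le
    (bound := fun _ => C) (s := Metric.closedBall x 1)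
    (F' := fun y t => (fderiv ℝ F (y, t)).comp (ContinuousLinearMap.inl ℝ X ℝ))
    (Metric.closedBall_mem_nhds x one_pos) ?_ ?_ ?_ ?_ ?_ ?_
  · exact Filter.Eventually.of_forall fun y => (hcx y).aestronglyMeasurable
  · exact (hcx x).intervalIntegrable _ _
  · exact (hc.comp (by fun_prop : Continuous fun t : ℝ => (x, t))).aestronglyMeasurable
  · refine Filter.Eventually.of_forall fun t ht y hy => hC (y, t) ⟨hy, ?_⟩
    rw [Set.uIoc_of_le zero_le_one] at ht
    exact ⟨ht.1.le, ht.2⟩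
  · exact intervalIntegrable_const
  · refine Filter.Eventually.of_forall fun t _ y _ => ?_
    have h1 : HasFDerivAt F (fderiv ℝ F (y, t)) (y, t) :=
      (hF.differentiable (by simp) _).hasFDerivAt
    exact h1.comp y (hasFDerivAt_prodMk_left y t)

/-- The target `E` varies in the induction on the order of differentiability, because the derivative
takes values in the continuous linear maps `X → E`. -/
theorem contDiff_integral_param_nat (k : ℕ) : ∀ {E : Type} [NormedAddCommGroup E]
    [NormedSpace ℝ E] {F : X × ℝ → E}, ContDiff ℝ ∞ F →
      ContDiff ℝ k (fun x => ∫ t in (0 : ℝ)..1, F (x, t)) := by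
  induction k with
  | zero =>
    intro E _ _ F hF
    have hcont : Continuous fun x => ∫ t in (0 : ℝ)..1, F (x, t) :=
      continuous_iff_continuousAt.2 fun x =>
        (hasFDerivAt_integral_param (hF.of_le (by simp)) x).continuousAt
    simpa using (contDiff_zero (𝕜 := ℝ)).2 hcont
  | succ k ih =>
    intro E _ _ F hF
    refine contDiff_succ_iff_hasFDerivAt.2
      ⟨fun x => ∫ t in (0 : ℝ)..1, (fderiv ℝ F (x, t)).comp (ContinuousLinearMap.inl ℝ X ℝ),
        ?_, fun x => hasFDerivAt_integral_param (hF.of_le (by simp)) x⟩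
    exact ih
      (F := fun q : X × ℝ => (fderiv ℝ F q).comp (ContinuousLinearMap.inl ℝ X ℝ))
      ((hF.fderiv_right (m := ∞) (by simp)).clm_comp contDiff_const)

theorem contDiff_integral_param {E : Type} [NormedAddCommGroup E] [NormedSpace ℝ E]
    {F : X × ℝ → E} (hF : ContDiff ℝ ∞ F) :
    ContDiff ℝ ∞ (fun x => ∫ t in (0 : ℝ)..1, F (x, t)) :=
  contDiff_infty.2 fun k => contDiff_integral_param_nat k hF

end ParametricIntegral

/-! ### Partial derivatives -/

variable {n m : ℕ}

theorem LocalFn.ext {f g : LocalFn n m} (h : ∀ z, f.eval z = g.eval z) : f = g :=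
  Subtype.ext (funext h)

theorem LocalFn.eval_mul (f g : LocalFn n m) (z : JetSpace n m) :
    (f * g).eval z = f.eval z * g.eval z := rfl

theorem LocalFn.eval_zero (z : JetSpace n m) : (0 : LocalFn n m).eval z = 0 := rfl

theorem LocalFn.eval_sum {ι : Type*} (s : Finset ι) (f : ι → LocalFn n m) (z : JetSpace n m) :
    (∑ c ∈ s, f c).eval z = ∑ c ∈ s, (f c).eval z := by
  classical
  induction s using Finset.induction_on with
  | empty => rfl
  | insert a s ha ih => rw [Finset.sum_insert ha, Finset.sum_insert ha, eval_add, ih]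

theorem eval_pderiv (c : Coord n m) (f : LocalFn n m) (z : JetSpace n m) :
    (pderiv c f).eval z = deriv (fun t : ℝ => f.eval (Function.update z c t)) (z c) := rfl

theorem eval_coord (c : Coord n m) (z : JetSpace n m) : (coord c).eval z = z c := rfl

theorem pderiv_mul (c : Coord n m) (f g : LocalFn n m) :
    pderiv c (f * g) = f * pderiv c g + g * pderiv c f := by
  refine LocalFn.ext fun z => ?_
  have h := deriv_fun_mul (IsLocal.differentiableAt f.2 c z) (IsLocal.differentiableAt g.2 c z)
  simp only [Function.update_eq_self] at h
  simp only [LocalFn.eval_add, LocalFn.eval_mul, eval_pderiv]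
  refine h.trans ?_
  simp only [LocalFn.eval]
  ring

theorem pderiv_coord (c d : Coord n m) :
    pderiv c (coord d : LocalFn n m) = if c = d then 1 else 0 := by
  refine LocalFn.ext fun z => ?_
  rw [eval_pderiv]
  simp only [eval_coord]
  split_ifs with h
  · subst h
    simp only [Function.update_self]
    exact deriv_id _
  · simp only [Function.update_of_ne (Ne.symm h)]
    exact deriv_const _ _

theorem pderiv_comm (c d : Coord n m) (f : LocalFn n m) :
    pderiv c (pderiv d f) = pderiv d (pderiv c f) := by
  obtain ⟨s, hc, hd, F, hF, h⟩ : ∃ s : Finset (Coord n m), c ∈ s ∧ d ∈ s ∧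
      ∃ F : (s → ℝ) → ℝ, ContDiff ℝ ∞ F ∧ ∀ z : JetSpace n m, f.1 z = F (fun c => z c) := by
    obtain ⟨s₀, F₀, hF₀, h₀⟩ := id f.2
    exact ⟨insert c (insert d s₀), by simp, by simp, IsLocal.enlarge hF₀ h₀
      ((Finset.subset_insert _ _).trans (Finset.subset_insert _ _))⟩
  have h1 : ∀ (e : Coord n m) (he : e ∈ s) (z : JetSpace n m),
      (pderiv e f).1 z = fderiv ℝ F (fun c => z c) (Pi.single ⟨e, he⟩ 1) :=
    fun e he z => (hasDerivAt_of_mem hF h he z).deriv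
  have hF' : ContDiff ℝ ∞ (fderiv ℝ F) := hF.fderiv_right (by simp)
  have h2 : ∀ (e : Coord n m) (he : e ∈ s) (e' : Coord n m) (he' : e' ∈ s) (z : JetSpace n m),
      (pderiv e' (pderiv e f)).eval z =
        fderiv ℝ (fderiv ℝ F) (fun c => z c) (Pi.single ⟨e', he'⟩ 1) (Pi.single ⟨e, he⟩ 1) := by
    intro e he e' he' z
    have h3 : ContDiff ℝ ∞ fun y => fderiv ℝ F y (Pi.single ⟨e, he⟩ 1) :=
      hF'.clm_apply contDiff_const
    refine ((hasDerivAt_of_mem h3 (h1 e he) he' z).deriv).trans ?_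
    rw [fderiv_clm_apply (hF'.differentiable (by simp) _) (by fun_prop)]
    simp
  refine LocalFn.ext fun z => ?_
  rw [h2 d hd c hc, h2 c hc d hd]
  have hs : IsSymmSndFDerivAt ℝ F (fun c => z c) :=
    hF.contDiffAt.isSymmSndFDerivAt (by
      rw [minSmoothness_of_isRCLikeNormedField]
      exact WithTop.coe_le_coe.2 (le_top : (2 : ℕ∞) ≤ ⊤))
  exact hs _ _

theorem finite_support_pderiv_coord (f : LocalFn n m) :
    (Function.support fun c : Coord n m => pderiv c f).Finite := by
  obtain ⟨f, s, F, hF, h⟩ := f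
  refine Set.Finite.subset s.finite_toSet fun c hc => ?_
  by_contra hcs
  exact hc (Subtype.ext (rawPartial_of_notMem h hcs))

/-! ### Vector fields on the jet space -/

/-- The vector field `∑_c a_c ∂/∂c` on the jet space, acting on local functions. The sum is
finite for each `f`. -/
noncomputable def vec (a : Coord n m → LocalFn n m) (f : LocalFn n m) : LocalFn n m :=
  ∑ᶠ c, a c * pderiv c f

theorem vec_eq_sum (a : Coord n m → LocalFn n m) (f : LocalFn n m) {s : Finset (Coord n m)}
    (hs : ∀ c ∉ s, pderiv c f = 0) : vec a f = ∑ c ∈ s, a c * pderiv c f := by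
  refine finsum_eq_sum_of_support_subset _ fun c hc => ?_
  by_contra h
  exact hc (by simp [hs c h])

theorem exists_finset_pderiv (f : LocalFn n m) :
    ∃ s : Finset (Coord n m), ∀ c ∉ s, pderiv c f = 0 :=
  ⟨(finite_support_pderiv_coord f).toFinset, fun c hc => by simpa using hc⟩

theorem exists_finset_pderiv₂ (f g : LocalFn n m) :
    ∃ s : Finset (Coord n m), (∀ c ∉ s, pderiv c f = 0) ∧ ∀ c ∉ s, pderiv c g = 0 := by
  obtain ⟨s, hs⟩ := exists_finset_pderiv f
  obtain ⟨t, ht⟩ := exists_finset_pderiv g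
  exact ⟨s ∪ t, fun c hc => hs c fun h => hc (Finset.mem_union_left _ h),
    fun c hc => ht c fun h => hc (Finset.mem_union_right _ h)⟩

theorem vec_add (a : Coord n m → LocalFn n m) (f g : LocalFn n m) :
    vec a (f + g) = vec a f + vec a g := by
  obtain ⟨s, hf, hg⟩ := exists_finset_pderiv₂ f g
  rw [vec_eq_sum a f hf, vec_eq_sum a g hg, vec_eq_sum a (f + g) (s := s), ← Finset.sum_add_distrib]
  · simp [mul_add]
  · intro c hc; simp [hf c hc, hg c hc]

theorem vec_mul (a : Coord n m → LocalFn n m) (f g : LocalFn n m) :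
    vec a (f * g) = f * vec a g + g * vec a f := by
  obtain ⟨s, hf, hg⟩ := exists_finset_pderiv₂ f g
  rw [vec_eq_sum a f hf, vec_eq_sum a g hg, vec_eq_sum a (f * g) (s := s), Finset.mul_sum,
    Finset.mul_sum, ← Finset.sum_add_distrib]
  · refine Finset.sum_congr rfl fun c _ => ?_
    rw [pderiv_mul]; ring
  · intro c hc; simp [pderiv_mul, hf c hc, hg c hc]

theorem vec_zero (a : Coord n m → LocalFn n m) : vec a 0 = 0 := by
  simp [vec]

theorem vec_sum {ι : Type*} (a : Coord n m → LocalFn n m) (s : Finset ι) (f : ι → LocalFn n m) :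
    vec a (∑ c ∈ s, f c) = ∑ c ∈ s, vec a (f c) :=
  map_sum (AddMonoidHom.mk' (vec a) (vec_add a)) f s

theorem vec_single (c : Coord n m) (f : LocalFn n m) : vec (Pi.single c 1) f = pderiv c f := by
  rw [vec, finsum_eq_single _ c]
  · simp
  · intro d hd; simp [hd]

/-- The commutator of two vector fields is the vector field whose coefficients are obtained by
applying each of them to the coefficients of the other. -/
theorem vec_vec_sub (a b : Coord n m → LocalFn n m) (f : LocalFn n m) :
    vec a (vec b f) - vec b (vec a f) = vec (fun c => vec a (b c) - vec b (a c)) f := by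
  obtain ⟨s, hs⟩ := exists_finset_pderiv f
  have hs' : ∀ d, ∀ c ∉ s, pderiv c (pderiv d f) = 0 := fun d c hc => by
    rw [pderiv_comm, hs c hc, map_zero]
  have key : ∀ a b : Coord n m → LocalFn n m, vec a (vec b f) =
      ∑ d ∈ s, vec a (b d) * pderiv d f +
        ∑ d ∈ s, ∑ c ∈ s, a c * b d * pderiv c (pderiv d f) := by
    intro a b
    rw [vec_eq_sum b f hs, vec_sum, ← Finset.sum_add_distrib]
    refine Finset.sum_congr rfl fun d _ => ?_
    rw [vec_mul, vec_eq_sum a _ (hs' d), Finset.mul_sum, mul_comm, add_comm]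
    congr 1
    refine Finset.sum_congr rfl fun c _ => ?_
    ring
  rw [key a b, key b a, vec_eq_sum _ f hs, Finset.sum_comm (s := s) (t := s)]
  simp only [sub_mul, Finset.sum_sub_distrib]
  have : ∀ d c, a d * b c * pderiv d (pderiv c f) = b c * a d * pderiv c (pderiv d f) :=
    fun d c => by rw [pderiv_comm, mul_comm (a d)]
  simp only [this]
  ring

/-! ### Total derivatives -/

/-- The coefficients of `∂_μ` as a vector field: the value of `∂_μ` on each coordinate. -/
noncomputable def totalCoeff (μ : Fin n) : Coord n m → LocalFn n m :=
  Sum.elim (fun ν => if ν = μ then 1 else 0)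
    (fun p => coord (Sum.inr (p.1, p.2 + Finsupp.single μ 1)))

theorem sumPartials_eq_sum (T : Fin m × MultiIndex n → Module.End ℝ (LocalFn n m))
    (f : LocalFn n m) {s : Finset (Fin m × MultiIndex n)}
    (hs : ∀ p ∉ s, pderiv (Sum.inr p) f = 0) :
    sumPartials T f = ∑ p ∈ s, T p (pderiv (Sum.inr p) f) := by
  refine finsum_eq_sum_of_support_subset _ fun p hp => ?_
  by_contra h
  exact hp (by simp [hs p h])

theorem exists_finset_pderiv_inr (f : LocalFn n m) :
    ∃ s : Finset (Fin m × MultiIndex n), ∀ p ∉ s, pderiv (Sum.inr p) f = 0 :=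
  ⟨(finite_support_pderiv f).toFinset, fun c hc => by simpa using hc⟩

theorem vec_eq_add_sumPartials (a : Coord n m → LocalFn n m) (f : LocalFn n m) :
    vec a f = ∑ μ, a (Sum.inl μ) * pderiv (Sum.inl μ) f +
      sumPartials (fun p => LinearMap.mulLeft ℝ (a (Sum.inr p))) f := by
  obtain ⟨s, hs⟩ := exists_finset_pderiv_inr f
  rw [sumPartials_eq_sum _ f hs, vec_eq_sum a f (s := Finset.univ.disjSum s), Finset.sum_disjSum]
  · rfl
  · rintro (μ | p) hp
    · simp at hp
    · exact hs p (by simpa using hp)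

theorem totalDeriv_eq_vec (μ : Fin n) (f : LocalFn n m) :
    totalDeriv μ f = vec (totalCoeff μ) f := by
  rw [vec_eq_add_sumPartials]
  simp [totalDeriv, totalCoeff]

theorem totalDeriv_mul (μ : Fin n) (f g : LocalFn n m) :
    totalDeriv μ (f * g) = f * totalDeriv μ g + g * totalDeriv μ f := by
  simp only [totalDeriv_eq_vec, vec_mul]

theorem totalDeriv_one (μ : Fin n) : totalDeriv μ (1 : LocalFn n m) = 0 := by
  have := totalDeriv_mul μ (1 : LocalFn n m) 1
  simpa using this

theorem vec_coord (a : Coord n m → LocalFn n m) (c : Coord n m) : vec a (coord c) = a c := by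
  rw [vec, finsum_eq_single _ c]
  · simp [pderiv_coord]
  · intro d hd; simp [pderiv_coord, hd]

theorem totalDeriv_coord (μ : Fin n) (p : Fin m × MultiIndex n) :
    totalDeriv μ (coord (Sum.inr p) : LocalFn n m) =
      coord (Sum.inr (p.1, p.2 + Finsupp.single μ 1)) := by
  rw [totalDeriv_eq_vec, vec_coord]; rfl

theorem vec_ite_one (a : Coord n m → LocalFn n m) (P : Prop) [Decidable P] :
    vec a (if P then 1 else 0) = 0 := by
  have := vec_mul a (1 : LocalFn n m) 1
  split_ifs
  · simpa using this
  · exact vec_zero a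

theorem totalDeriv_comm (μ ν : Fin n) (f : LocalFn n m) :
    totalDeriv μ (totalDeriv ν f) = totalDeriv ν (totalDeriv μ f) := by
  simp only [totalDeriv_eq_vec]
  rw [← sub_eq_zero, vec_vec_sub]
  have : (fun c => vec (totalCoeff μ) (totalCoeff ν c) - vec (totalCoeff ν) (totalCoeff μ c)) =
      (0 : Coord n m → LocalFn n m) := by
    funext c
    rcases c with κ | p
    · simp [totalCoeff, vec_ite_one]
    · simp only [totalCoeff, Sum.elim_inr, vec_coord, Pi.zero_apply]
      rw [add_assoc, add_assoc, add_comm (Finsupp.single μ 1), sub_self]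
  rw [this]
  simp [vec]

theorem totalDeriv_commute (μ ν : Fin n) :
    Commute (totalDeriv μ : Module.End ℝ (LocalFn n m)) (totalDeriv ν) :=
  LinearMap.ext fun f => totalDeriv_comm μ ν f

/-- The commutator `[∂/∂φ^i_I, ∂_μ] = ∂/∂φ^i_{I-μ}` (zero if `I_μ = 0`), summed against an arbitrary
family of operators. -/
theorem sumPartials_totalDeriv (T : Fin m × MultiIndex n → Module.End ℝ (LocalFn n m)) (μ : Fin n)
    (f : LocalFn n m) :
    sumPartials T (totalDeriv μ f) =
      sumPartials (fun p => T p * totalDeriv μ + T (p.1, p.2 + Finsupp.single μ 1)) f := by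
  classical
  obtain ⟨s, hs⟩ := exists_finset_pderiv_inr f
  let e : Fin m × MultiIndex n → Fin m × MultiIndex n := fun p => (p.1, p.2 + Finsupp.single μ 1)
  have he : Function.Injective e := by
    rintro ⟨i, I⟩ ⟨j, J⟩ h
    simpa [e] using h
  have key : ∀ p, pderiv (Sum.inr p) (totalDeriv μ f) =
      totalDeriv μ (pderiv (Sum.inr p) f) +
        ∑ q ∈ s, if e q = p then pderiv (Sum.inr q) f else 0 := by
    intro p
    rw [← sub_eq_iff_eq_add']
    have h := vec_vec_sub (Pi.single (Sum.inr p) 1) (totalCoeff μ) f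
    rw [vec_single, vec_single, ← totalDeriv_eq_vec, ← totalDeriv_eq_vec] at h
    rw [h, vec_eq_add_sumPartials, sumPartials_eq_sum _ f hs]
    rw [Finset.sum_eq_zero, zero_add]
    · refine Finset.sum_congr rfl fun q _ => ?_
      have h2 : (Pi.single (Sum.inr p) 1 : Coord n m → LocalFn n m) (Sum.inr q) =
          if q = p then 1 else 0 := by
        rw [Pi.single_apply]; simp
      have h3 : totalCoeff μ (Sum.inr q) = (coord (Sum.inr (e q)) : LocalFn n m) := rfl
      rw [h2, h3, vec_ite_one, vec_coord, Pi.single_apply]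
      by_cases hq : e q = p <;> simp [hq]
    · intro ν _
      have h2 : (Pi.single (Sum.inr p) 1 : Coord n m → LocalFn n m) (Sum.inl ν) = 0 := by simp
      have h3 : totalCoeff μ (Sum.inl ν) = (if ν = μ then 1 else 0 : LocalFn n m) := rfl
      rw [h2, h3, vec_ite_one, vec_zero, sub_self, zero_mul]
  rw [sumPartials_eq_sum _ _ (s := s ∪ s.image e), sumPartials_eq_sum _ f hs]
  · simp only [key, map_add, LinearMap.add_apply, Module.End.mul_apply, Finset.sum_add_distrib]
    congr 1
    · symm
      refine Finset.sum_subset Finset.subset_union_left fun p _ hp => ?_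
      simp [hs p hp]
    · simp only [map_sum]
      rw [Finset.sum_comm]
      refine Finset.sum_congr rfl fun q hq => ?_
      rw [Finset.sum_eq_single (e q)]
      · simp [e]
      · intro p _ hp; simp [Ne.symm hp]
      · intro h
        exact absurd (Finset.mem_union_right _ (Finset.mem_image_of_mem e hq)) h
  · intro p hp
    rw [key, hs p fun h => hp (Finset.mem_union_left _ h), map_zero, zero_add]
    refine Finset.sum_eq_zero fun q hq => if_neg ?_
    rintro rfl
    exact hp (Finset.mem_union_right _ (Finset.mem_image_of_mem e hq))

/-! ### Scaling homotopies -/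

theorem LocalFn.contDiff_comp {X : Type*} [NormedAddCommGroup X] [NormedSpace ℝ X]
    (f : LocalFn n m) {γ : X → JetSpace n m} (hγ : ∀ c, ContDiff ℝ ∞ fun q => γ q c) :
    ContDiff ℝ ∞ fun q => f.eval (γ q) := by
  obtain ⟨f, s, F, hF, h⟩ := f
  have : (fun q => F (fun c : s => γ q c)) = fun q => LocalFn.eval ⟨f, s, F, hF, h⟩ (γ q) :=
    funext fun q => (h (γ q)).symm
  rw [← this]
  exact hF.comp (contDiff_pi.2 fun c => hγ c)

/-- The chain rule for a local function along a curve in the jet space. -/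
theorem LocalFn.hasDerivAt_comp (f : LocalFn n m) {s : Finset (Coord n m)}
    (hs : ∀ c ∉ s, pderiv c f = 0) {γ : ℝ → JetSpace n m} {γ' : Coord n m → ℝ} {t : ℝ}
    (hγ : ∀ c, HasDerivAt (fun u => γ u c) (γ' c) t) :
    HasDerivAt (fun u => f.eval (γ u)) (∑ c ∈ s, γ' c * (pderiv c f).eval (γ t)) t := by
  obtain ⟨s₀, F, hF, h⟩ := id f.2
  have h0 : ∀ c ∉ s₀, pderiv c f = 0 := fun c hc => Subtype.ext (rawPartial_of_notMem h hc)
  have h1 : ∀ c (hc : c ∈ s₀) (z : JetSpace n m),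
      (pderiv c f).eval z = fderiv ℝ F (fun c => z c) (Pi.single ⟨c, hc⟩ 1) :=
    fun c hc z => (hasDerivAt_of_mem hF h hc z).deriv
  have e1 : ∑ c ∈ s, γ' c * (pderiv c f).eval (γ t) =
      ∑ c ∈ s₀, γ' c * (pderiv c f).eval (γ t) := by
    classical
    refine (Finset.sum_subset (Finset.subset_union_left (s₂ := s₀)) fun c _ hc => ?_).trans
      (Finset.sum_subset (Finset.subset_union_right (s₁ := s)) fun c _ hc => ?_).symm
    · rw [hs c hc, eval_zero, mul_zero]
    · rw [h0 c hc, eval_zero, mul_zero]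
  have e2 : (fun u => f.eval (γ u)) = F ∘ fun u => (fun c : s₀ => γ u c) := funext fun u => h _
  have e3 : HasDerivAt (fun u => (fun c : s₀ => γ u c)) (fun c : s₀ => γ' c) t :=
    hasDerivAt_pi.2 fun c => hγ c
  rw [e1, e2]
  convert! ((hF.differentiable (by simp)) _).hasFDerivAt.comp_hasDerivAt t e3 using 1
  have e4 := (fderiv ℝ F fun c : s₀ => γ t c).toLinearMap.pi_apply_eq_sum_univ
    (fun c : s₀ => γ' c)
  rw [ContinuousLinearMap.coe_coe] at e4
  rw [e4, ← Finset.sum_coe_sort s₀]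
  refine Finset.sum_congr rfl fun c _ => ?_
  rw [h1 c c.2, smul_eq_mul]
  congr 2
  ext d
  rw [Pi.single_apply]
  exact if_congr eq_comm rfl rfl

open Classical in
/-- Multiplication of the coordinates in `P` by `t`. -/
noncomputable def scale (P : Set (Coord n m)) (t : ℝ) (z : JetSpace n m) : JetSpace n m :=
  fun c => if c ∈ P then t * z c else z c

theorem contDiff_scale {X : Type*} [NormedAddCommGroup X] [NormedSpace ℝ X]
    (P : Set (Coord n m)) {τ : X → ℝ} {γ : X → JetSpace n m} (hτ : ContDiff ℝ ∞ τ)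
    (hγ : ∀ c, ContDiff ℝ ∞ fun q => γ q c) (c : Coord n m) :
    ContDiff ℝ ∞ fun q => scale P (τ q) (γ q) c := by
  unfold scale
  split_ifs
  · exact hτ.mul (hγ c)
  · exact hγ c

open Classical in
/-- The point of the jet space with the given coordinates in `s` and zero coordinates elsewhere. -/
noncomputable def extendZero {s : Finset (Coord n m)} (y : s → ℝ) : JetSpace n m :=
  fun c => if h : c ∈ s then y ⟨c, h⟩ else 0

theorem contDiff_extendZero {s : Finset (Coord n m)} (c : Coord n m) :
    ContDiff ℝ ∞ fun y : s → ℝ => extendZero y c := by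
  unfold extendZero
  split_ifs with h
  · exact contDiff_apply ℝ ℝ (⟨c, h⟩ : s)
  · exact contDiff_const

theorem LocalFn.exists_finset_scale (f : LocalFn n m) :
    ∃ s : Finset (Coord n m), ∀ (P : Set (Coord n m)) (t : ℝ) (z : JetSpace n m),
      f.eval (scale P t z) = f.eval (scale P t (extendZero fun c : s => z c)) := by
  obtain ⟨f, s, F, hF, h⟩ := f
  refine ⟨s, fun P t z => ?_⟩
  have : (fun c : s => scale P t z c) =
      fun c : s => scale P t (extendZero fun c : s => z c) c := by
    funext c
    simp [scale, extendZero]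
  exact (h _).trans ((congrArg F this).trans (h _).symm)

theorem LocalFn.continuous_scale (f : LocalFn n m) (P : Set (Coord n m)) (z : JetSpace n m) :
    Continuous fun t => f.eval (scale P t z) :=
  (f.contDiff_comp (γ := fun t => scale P t z)
    (contDiff_scale P contDiff_id fun _ => contDiff_const)).continuous

theorem LocalFn.continuous_pow_scale (f : LocalFn n m) (P : Set (Coord n m)) (k : ℕ)
    (z : JetSpace n m) : Continuous fun t => t ^ k * f.eval (scale P t z) :=
  (continuous_pow k).mul (f.continuous_scale P z)

/-- The local function `z ↦ ∫₀¹ t^k f(t · z) dt`, where `t` scales the coordinates in `P`. -/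
noncomputable def scaleInt (P : Set (Coord n m)) (k : ℕ) : Module.End ℝ (LocalFn n m) where
  toFun f := ⟨fun z => ∫ t in (0 : ℝ)..1, t ^ k * f.eval (scale P t z), by
    obtain ⟨s, hs⟩ := f.exists_finset_scale
    refine ⟨s, fun y => ∫ t in (0 : ℝ)..1, t ^ k * f.eval (scale P t (extendZero y)), ?_, ?_⟩
    · refine contDiff_integral_param
        (F := fun q : (s → ℝ) × ℝ => q.2 ^ k * f.eval (scale P q.2 (extendZero q.1))) ?_
      exact (contDiff_snd.pow k).mul (f.contDiff_comp (contDiff_scale P contDiff_snd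
        fun c => (contDiff_extendZero c).comp contDiff_fst))
    · intro z
      simp only [hs P _ z]⟩
  map_add' f g := by
    refine Subtype.ext (funext fun z => ?_)
    simp only [LocalFn.eval_add, mul_add]
    exact intervalIntegral.integral_add
      ((f.continuous_pow_scale P k z).intervalIntegrable _ _)
      ((g.continuous_pow_scale P k z).intervalIntegrable _ _)
  map_smul' a f := by
    refine Subtype.ext (funext fun z => ?_)
    simp only [LocalFn.eval_smul, mul_left_comm _ a]
    exact intervalIntegral.integral_const_mul _ _

theorem eval_scaleInt (P : Set (Coord n m)) (k : ℕ) (f : LocalFn n m) (z : JetSpace n m) :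
    (scaleInt P k f).eval z = ∫ t in (0 : ℝ)..1, t ^ k * f.eval (scale P t z) := rfl

theorem hasDerivAt_update_coord (z : JetSpace n m) (c : Coord n m) (r v : ℝ) (d : Coord n m) :
    HasDerivAt (fun u => Function.update z c (r * u) d)
      (if d = c then r else 0) v := by
  by_cases h : d = c
  · subst h
    simpa using (hasDerivAt_id v).const_mul r
  · simpa [h] using hasDerivAt_const v (z d)

/-- Differentiation under the integral sign. Here `r t` is the factor by which the scaling with
parameter `t` multiplies the coordinate `c`: it is `t` if `c ∈ P` and `1` otherwise. -/
theorem pderiv_scaleInt_aux (P : Set (Coord n m)) (k : ℕ) (c : Coord n m) (f : LocalFn n m)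
    (z : JetSpace n m) (r : ℝ → ℝ)
    (hr : ∀ t u, scale P t (Function.update z c u) = Function.update (scale P t z) c (r t * u)) :
    (pderiv c (scaleInt P k f)).eval z =
      ∫ t in (0 : ℝ)..1, t ^ k * (r t * (pderiv c f).eval (scale P t z)) := by
  obtain ⟨s₀, hs₀⟩ := exists_finset_pderiv f
  have hs : ∀ d ∉ insert c s₀, pderiv d f = 0 := fun d hd =>
    hs₀ d fun h => hd (Finset.mem_insert_of_mem h)
  rw [eval_pderiv]
  simp only [eval_scaleInt]
  have hF : ContDiff ℝ ∞ fun q : ℝ × ℝ =>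
      q.2 ^ k * f.eval (scale P q.2 (Function.update z c q.1)) := by
    refine (contDiff_snd.pow k).mul (f.contDiff_comp (contDiff_scale P contDiff_snd fun d => ?_))
    by_cases h : d = c
    · subst h; simpa using contDiff_fst
    · simpa [h] using contDiff_const
  have h1 := (hasFDerivAt_integral_param (hF.of_le (by simp)) (z c)).hasDerivAt.deriv
  refine h1.trans ?_
  have hc : Continuous fun t : ℝ => (fderiv ℝ (fun q : ℝ × ℝ =>
      q.2 ^ k * f.eval (scale P q.2 (Function.update z c q.1))) (z c, t)).comp
        (ContinuousLinearMap.inl ℝ ℝ ℝ) :=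
    ((hF.continuous_fderiv (by simp)).comp (by fun_prop : Continuous fun t : ℝ => (z c, t))).clm_comp
      continuous_const
  rw [ContinuousLinearMap.intervalIntegral_apply (hc.intervalIntegrable _ _)]
  refine intervalIntegral.integral_congr fun t _ => ?_
  have h2 : HasDerivAt (fun u => t ^ k * f.eval (scale P t (Function.update z c u)))
      (t ^ k * (r t * (pderiv c f).eval (scale P t z))) (z c) := by
    refine HasDerivAt.const_mul _ ?_
    simp only [hr]
    convert! f.hasDerivAt_comp hs (hasDerivAt_update_coord (scale P t z) c (r t) (z c)) using 1
    rw [← hr, Function.update_eq_self]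
    simp
  have h3 := ((hF.differentiable (by simp) (z c, t)).hasFDerivAt.comp (z c)
    (hasFDerivAt_prodMk_left (𝕜 := ℝ) (z c) t)).hasDerivAt
  exact h3.unique h2

theorem pderiv_scaleInt_of_mem {P : Set (Coord n m)} {c : Coord n m} (hc : c ∈ P) (k : ℕ)
    (f : LocalFn n m) : pderiv c (scaleInt P k f) = scaleInt P (k + 1) (pderiv c f) := by
  refine LocalFn.ext fun z => ?_
  rw [pderiv_scaleInt_aux P k c f z id, eval_scaleInt]
  · simp only [id, pow_succ, mul_assoc]
  · intro t u
    funext d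
    by_cases h : d = c
    · subst h; simp [scale, hc]
    · simp [scale, h]

theorem pderiv_scaleInt_of_notMem {P : Set (Coord n m)} {c : Coord n m} (hc : c ∉ P) (k : ℕ)
    (f : LocalFn n m) : pderiv c (scaleInt P k f) = scaleInt P k (pderiv c f) := by
  refine LocalFn.ext fun z => ?_
  rw [pderiv_scaleInt_aux P k c f z fun _ => 1, eval_scaleInt]
  · simp only [one_mul]
  · intro t u
    funext d
    by_cases h : d = c
    · subst h; simp [scale, hc]
    · simp [scale, h]

theorem scaleInt_coord_mul {P : Set (Coord n m)} {c : Coord n m} (hc : c ∈ P) (k : ℕ)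
    (f : LocalFn n m) : scaleInt P k (coord c * f) = coord c * scaleInt P (k + 1) f := by
  refine LocalFn.ext fun z => ?_
  simp only [LocalFn.eval_mul, eval_scaleInt, eval_coord]
  rw [← intervalIntegral.integral_const_mul]
  refine intervalIntegral.integral_congr fun t _ => ?_
  simp only [scale, hc, if_true]
  ring

/-- The restriction of a local function to the locus where the coordinates in `P` vanish. -/
noncomputable def restrictZero (P : Set (Coord n m)) (f : LocalFn n m) : LocalFn n m :=
  ⟨fun z => f.eval (scale P 0 z), by
    obtain ⟨s, hs⟩ := f.exists_finset_scale
    exact ⟨s, fun y => f.eval (scale P 0 (extendZero y)),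
      f.contDiff_comp (contDiff_scale P contDiff_const contDiff_extendZero), fun z => hs P 0 z⟩⟩

theorem eval_restrictZero (P : Set (Coord n m)) (f : LocalFn n m) (z : JetSpace n m) :
    (restrictZero P f).eval z = f.eval (scale P 0 z) := rfl

theorem pderiv_restrictZero {P : Set (Coord n m)} {c : Coord n m} (hc : c ∈ P)
    (f : LocalFn n m) : pderiv c (restrictZero P f) = 0 := by
  refine LocalFn.ext fun z => ?_
  rw [eval_pderiv, LocalFn.eval_zero]
  have : ∀ t, scale P 0 (Function.update z c t) = scale P 0 z := by
    intro t
    funext d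
    by_cases h : d = c
    · subst h; simp [scale, hc]
    · simp [scale, h]
  simp [eval_restrictZero, this]

theorem eq_restrictZero_add_sum (P : Set (Coord n m)) (f : LocalFn n m) {s : Finset (Coord n m)}
    (hsP : ∀ c ∈ s, c ∈ P) (hs : ∀ c ∈ P, c ∉ s → pderiv c f = 0) :
    f = restrictZero P f + ∑ c ∈ s, coord c * scaleInt P 0 (pderiv c f) := by
  classical
  refine LocalFn.ext fun z => ?_
  simp only [LocalFn.eval_add, LocalFn.eval_sum, LocalFn.eval_mul, eval_coord, eval_restrictZero,
    eval_scaleInt, pow_zero, one_mul]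
  obtain ⟨s₀, hs₀⟩ := exists_finset_pderiv f
  have h1 : ∀ t, HasDerivAt (fun u => f.eval (scale P u z))
      (∑ c ∈ s, z c * (pderiv c f).eval (scale P t z)) t := by
    intro t
    have h2 : ∀ c, HasDerivAt (fun u => scale P u z c) (if c ∈ P then z c else 0) t := by
      intro c
      by_cases h : c ∈ P
      · simpa [scale, h] using (hasDerivAt_id t).mul_const (z c)
      · simpa [scale, h] using hasDerivAt_const t (z c)
    convert! f.hasDerivAt_comp (s := s ∪ s₀)
      (fun c hc => hs₀ c fun h => hc (Finset.mem_union_right _ h)) h2 using 1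
    rw [← Finset.sum_subset (Finset.subset_union_left (s₁ := s) (s₂ := s₀))]
    · exact Finset.sum_congr rfl fun c hc => by rw [if_pos (hsP c hc)]
    · intro c _ hc
      by_cases h : c ∈ P
      · rw [hs c h hc, LocalFn.eval_zero, mul_zero]
      · rw [if_neg h, zero_mul]
  have hcont : ∀ c, Continuous fun t => z c * (pderiv c f).eval (scale P t z) := fun c =>
    ((pderiv c f).continuous_scale P z).const_mul _
  have h3 := intervalIntegral.integral_eq_sub_of_hasDerivAt (a := 0) (b := 1)
    (fun t _ => h1 t) ((continuous_finsetSum s fun c _ => hcont c).intervalIntegrable _ _)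
  rw [intervalIntegral.integral_finsetSum fun c _ => (hcont c).intervalIntegrable _ _] at h3
  simp only [intervalIntegral.integral_const_mul] at h3
  have h4 : scale P 1 z = z := by funext c; simp [scale]
  rw [h3, h4]
  ring

/-- The local functions all of whose partial derivatives vanish are the constants. -/
theorem eq_algebraMap_of_pderiv_eq_zero {f : LocalFn n m} (h : ∀ c, pderiv c f = 0) :
    ∃ C : ℝ, f = algebraMap ℝ (LocalFn n m) C := by
  refine ⟨f.eval 0, LocalFn.ext fun z => ?_⟩
  have h1 := eq_restrictZero_add_sum Set.univ f (s := ∅) (by simp) fun c _ _ => h c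
  rw [Finset.sum_empty, add_zero] at h1
  rw [h1]
  change f.eval (scale Set.univ 0 z) = f.eval (scale Set.univ 0 0)
  congr 1
  funext c
  simp [scale]

/-- Here `coord c * scaleInt {c} 0 f` is the primitive of `f` in the coordinate `c` that vanishes where
`c` does. -/
theorem pderiv_coord_mul_scaleInt (c : Coord n m) (f : LocalFn n m) :
    pderiv c (coord c * scaleInt {c} 0 f) = f := by
  refine LocalFn.ext fun z => ?_
  rw [eval_pderiv]
  have h1 : ∀ u t, scale {c} t (Function.update z c u) = Function.update z c (t * u) := by
    intro u t
    funext d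
    by_cases h : d = c
    · subst h; simp [scale]
    · simp [scale, h]
  have h2 : (fun u => (coord c * scaleInt {c} 0 f).eval (Function.update z c u)) =
      fun u => ∫ t in (0 : ℝ)..u, f.eval (Function.update z c t) := by
    funext u
    simp only [LocalFn.eval_mul, eval_coord, eval_scaleInt, pow_zero, one_mul,
      Function.update_self, h1]
    have := intervalIntegral.smul_integral_comp_mul_right (a := 0) (b := 1)
      (fun t => f.eval (Function.update z c t)) u
    simpa using this
  rw [h2]
  have hc : Continuous fun t => f.eval (Function.update z c t) := by
    refine (f.contDiff_comp fun d => ?_).continuous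
    by_cases h : d = c
    · subst h; simpa using! (contDiff_id : ContDiff ℝ ∞ (id : ℝ → ℝ))
    · simpa [h] using contDiff_const
  rw [hc.deriv_integral, Function.update_eq_self]

theorem pderiv_scaleInt_eq_zero {P : Set (Coord n m)} {c : Coord n m} (hc : c ∉ P) (k : ℕ)
    {f : LocalFn n m} (h : pderiv c f = 0) : pderiv c (scaleInt P k f) = 0 := by
  rw [pderiv_scaleInt_of_notMem hc, h, map_zero]

/-- The homotopy that scales all the `φ^i_I`. -/
noncomputable def fibreInt : Module.End ℝ (LocalFn n m) := scaleInt (Set.range Sum.inr) 0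

theorem totalDeriv_eq_add_sum (μ : Fin n) (f : LocalFn n m)
    {s : Finset (Fin m × MultiIndex n)} (hs : ∀ p ∉ s, pderiv (Sum.inr p) f = 0) :
    totalDeriv μ f = pderiv (Sum.inl μ) f +
      ∑ p ∈ s, coord (Sum.inr (p.1, p.2 + Finsupp.single μ 1)) * pderiv (Sum.inr p) f := by
  rw [totalDeriv, LinearMap.add_apply, sumPartials_eq_sum _ f hs]
  rfl

theorem totalDeriv_fibreInt (μ : Fin n) (f : LocalFn n m) :
    totalDeriv μ (fibreInt f) = fibreInt (totalDeriv μ f) := by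
  obtain ⟨s, hs⟩ := exists_finset_pderiv_inr f
  have h1 : ∀ p, pderiv (Sum.inr p) (fibreInt f) =
      scaleInt (Set.range Sum.inr) 1 (pderiv (Sum.inr p) f) := fun p =>
    pderiv_scaleInt_of_mem (Set.mem_range_self p) 0 f
  rw [totalDeriv_eq_add_sum μ f hs, totalDeriv_eq_add_sum μ (fibreInt f) (s := s), map_add, map_sum]
  · congr 1
    · exact pderiv_scaleInt_of_notMem (by simp) 0 f
    · refine Finset.sum_congr rfl fun p _ => ?_
      rw [h1]
      exact (scaleInt_coord_mul (Set.mem_range_self _) 0 _).symm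
  · intro p hp
    rw [h1, hs p hp, map_zero]

/-! ### Iterated total derivatives -/

theorem MultiIndex.induction {p : MultiIndex n → Prop} (h0 : p 0)
    (hs : ∀ I μ, p I → p (I + Finsupp.single μ 1)) (I : MultiIndex n) : p I := by
  induction I using Finsupp.induction₂ with
  | zero => exact h0
  | add_single μ b f _ _ hf =>
    clear * - hf hs
    induction b with
    | zero => simpa using hf
    | succ b ih =>
      rw [Finsupp.single_add, ← add_assoc]
      exact hs _ _ ih

theorem multiPow_zero {A : Type*} [Monoid A] (T : Fin n → A) : multiPow T 0 = 1 := by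
  refine List.prod_eq_one fun x hx => ?_
  obtain ⟨μ, _, rfl⟩ := List.mem_map.1 hx
  simp

theorem multiPow_add_single {A : Type*} [Monoid A] {T : Fin n → A}
    (hT : ∀ μ ν, Commute (T μ) (T ν)) (I : MultiIndex n) (μ : Fin n) :
    multiPow T (I + Finsupp.single μ 1) = T μ * multiPow T I := by
  have key : ∀ l : List (Fin n), l.Nodup →
      (l.map fun ν => T ν ^ (I + Finsupp.single μ 1 : MultiIndex n) ν).prod =
        (if μ ∈ l then T μ else 1) * (l.map fun ν => T ν ^ I ν).prod := by
    intro l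
    induction l with
    | nil => simp
    | cons ν l ih =>
      intro hl
      rw [List.nodup_cons] at hl
      rw [List.map_cons, List.prod_cons, ih hl.2, List.map_cons, List.prod_cons]
      by_cases h : ν = μ
      · subst h
        rw [if_neg hl.1, if_pos List.mem_cons_self]
        simp [pow_succ', mul_assoc]
      · have h' : μ ≠ ν := Ne.symm h
        have h3 : (I + Finsupp.single μ 1 : MultiIndex n) ν = I ν := by simp [h]
        have h4 : μ ∈ ν :: l ↔ μ ∈ l := by simp [h']
        simp only [h3, h4]
        split_ifs
        · rw [← mul_assoc, ← ((hT μ ν).pow_right (I ν)).eq, mul_assoc]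
        · simp
  have := key (List.finRange n) (List.nodup_finRange n)
  rwa [if_pos (List.mem_finRange μ)] at this

theorem totalD_zero : totalD (0 : MultiIndex n) = (1 : Module.End ℝ (LocalFn n m)) :=
  multiPow_zero _

theorem totalD_add_single (I : MultiIndex n) (μ : Fin n) (f : LocalFn n m) :
    totalD (I + Finsupp.single μ 1) f = totalDeriv μ (totalD I f) := by
  rw [totalD, multiPow_add_single totalDeriv_commute]; rfl

/-- A linear map that commutes with the total derivatives commutes with the iterated ones. -/
theorem totalD_map_comm {G : Module.End ℝ (LocalFn n m)}
    (hG : ∀ μ f, totalDeriv μ (G f) = G (totalDeriv μ f)) (I : MultiIndex n) (f : LocalFn n m) :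
    totalD I (G f) = G (totalD I f) := by
  induction I using MultiIndex.induction with
  | h0 => simp [totalD_zero]
  | hs I μ ih => rw [totalD_add_single, ih, hG, totalD_add_single]

theorem totalD_totalDeriv (I : MultiIndex n) (μ : Fin n) (f : LocalFn n m) :
    totalD I (totalDeriv μ f) = totalDeriv μ (totalD I f) :=
  totalD_map_comm (fun ν f => totalDeriv_comm ν μ f) I f

theorem totalD_coord (I K : MultiIndex n) (i : Fin m) :
    totalD I (coord (Sum.inr (i, K)) : LocalFn n m) = coord (Sum.inr (i, K + I)) := by
  induction I using MultiIndex.induction with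
  | h0 => simp [totalD_zero]
  | hs I μ ih => rw [totalD_add_single, ih, totalDeriv_coord, add_assoc]

theorem MultiIndex.degree_add_single (I : MultiIndex n) (μ : Fin n) :
    (I + Finsupp.single μ 1).degree = I.degree + 1 := by
  rw [map_add, Finsupp.degree_single]

/-! ### Total divergences and integration by parts -/

/-- The total divergences `∑_{μ ∈ A} ∂_μ h^μ` along the directions in `A` of families `h^μ` taken
from the ideal `J`. -/
def divergences (J : Ideal (LocalFn n m)) (A : Finset (Fin n)) : Submodule ℝ (LocalFn n m) where
  carrier := {f | ∃ h : Fin n → LocalFn n m, (∀ μ, h μ ∈ J) ∧ f = ∑ μ ∈ A, totalDeriv μ (h μ)}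
  add_mem' := by
    rintro _ _ ⟨h, hJ, rfl⟩ ⟨h', hJ', rfl⟩
    exact ⟨h + h', fun μ => J.add_mem (hJ μ) (hJ' μ), by simp [Finset.sum_add_distrib]⟩
  zero_mem' := ⟨0, fun _ => J.zero_mem, by simp⟩
  smul_mem' := by
    rintro a _ ⟨h, hJ, rfl⟩
    exact ⟨a • h, fun μ => Submodule.smul_of_tower_mem J a (hJ μ), by simp [Finset.smul_sum]⟩

theorem totalDeriv_mem_divergences {J : Ideal (LocalFn n m)} {A : Finset (Fin n)} {μ : Fin n}
    (hμ : μ ∈ A) {f : LocalFn n m} (hf : f ∈ J) : totalDeriv μ f ∈ divergences J A := by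
  refine ⟨Pi.single μ f, fun ν => ?_, ?_⟩
  · rw [Pi.single_apply]; split_ifs
    exacts [hf, J.zero_mem]
  · rw [Finset.sum_eq_single μ]
    · simp
    · intro ν _ h; simp [h]
    · exact fun h => absurd hμ h

/-- Integration by parts: `a ∂_I b` and `(-1)^{|I|} (∂_I a) b` agree up to a divergence. -/
theorem mul_totalD_sub_mem {J : Ideal (LocalFn n m)} (hJ : ∀ μ, ∀ f ∈ J, totalDeriv μ f ∈ J)
    {A : Finset (Fin n)} (I : MultiIndex n) (hI : ∀ ν ∉ A, I ν = 0) (a : LocalFn n m)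
    {b : LocalFn n m} (hb : b ∈ J) :
    a * totalD I b - (-1 : ℝ) ^ I.degree • (totalD I a * b) ∈ divergences J A := by
  induction I using MultiIndex.induction generalizing a with
  | h0 => simp [totalD_zero]
  | hs I μ ih =>
    have hI' : ∀ ν ∉ A, I ν = 0 := fun ν hν => by
      have := hI ν hν
      rw [Finsupp.add_apply] at this
      omega
    have hμ : μ ∈ A := by
      by_contra h
      have := hI μ h
      simp at this
    have hD : totalD I b ∈ J := by
      clear * - hb hJ
      induction I using MultiIndex.induction with
      | h0 => simpa [totalD_zero] using hb
      | hs I μ ih => rw [totalD_add_single]; exact hJ _ _ ih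
    have h1 := ih hI' (totalDeriv μ a)
    have h2 := totalDeriv_mem_divergences hμ (J.mul_mem_left a hD)
    convert! sub_mem h2 h1 using 1
    rw [totalDeriv_mul, totalD_add_single, totalD_add_single, totalD_totalDeriv,
      MultiIndex.degree_add_single, pow_succ, mul_neg_one, neg_smul]
    ring

/-! ### Euler operators along some of the directions -/

open Classical in
/-- The operator that `partialEuler A i K` applies to `∂f/∂φ_p`. It is nonzero only if `p` is
`φ^i_{I+K}` with `I` in the directions in `A`, for the part of `K` off `A`. -/
noncomputable def partialEulerCoeff (A : Finset (Fin n)) (i : Fin m) (K : MultiIndex n)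
    (p : Fin m × MultiIndex n) : Module.End ℝ (LocalFn n m) :=
  if p.1 = i ∧ ∀ ν ∉ A, p.2 ν = K ν then
    (-1 : ℝ) ^ (p.2.filter (· ∈ A)).degree • totalD (p.2.filter (· ∈ A)) else 0

/-- The Euler operator `∑_I (-1)^{|I|} ∂_I ∂/∂φ^i_{I+K}`, where `I` runs over the multi-indices in
the directions in `A`: the Euler-Lagrange derivative along these directions with respect to
`φ^i_K`, when `∂_K φ^i` is regarded as a separate field for each multi-index `K` in the remaining
directions. The components of `K` along `A` are ignored. -/
noncomputable def partialEuler (A : Finset (Fin n)) (i : Fin m) (K : MultiIndex n) :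
    Module.End ℝ (LocalFn n m) :=
  sumPartials (partialEulerCoeff A i K)

theorem partialEulerCoeff_totalDeriv (A : Finset (Fin n)) (i : Fin m) (K : MultiIndex n)
    (p : Fin m × MultiIndex n) (μ : Fin n) (f : LocalFn n m) :
    partialEulerCoeff A i K p (totalDeriv μ f) = totalDeriv μ (partialEulerCoeff A i K p f) := by
  unfold partialEulerCoeff
  split_ifs
  · simp [totalD_totalDeriv]
  · simp

theorem partialEulerCoeff_add_of_mem {A : Finset (Fin n)} {μ : Fin n} (hμ : μ ∈ A) (i : Fin m)
    (K : MultiIndex n) (p : Fin m × MultiIndex n) (f : LocalFn n m) :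
    partialEulerCoeff A i K (p.1, p.2 + Finsupp.single μ 1) f =
      -totalDeriv μ (partialEulerCoeff A i K p f) := by
  have h1 : (∀ ν ∉ A, (p.2 + Finsupp.single μ 1 : MultiIndex n) ν = K ν) ↔
      ∀ ν ∉ A, p.2 ν = K ν := by
    refine forall₂_congr fun ν hν => ?_
    have : μ ≠ ν := fun h => hν (h ▸ hμ)
    simp [this]
  have h2 : (p.2 + Finsupp.single μ 1).filter (· ∈ A) =
      p.2.filter (· ∈ A) + Finsupp.single μ 1 := by
    rw [Finsupp.filter_add, Finsupp.filter_single_of_pos _ hμ]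
  unfold partialEulerCoeff
  simp only [h1, h2]
  split_ifs
  · simp [MultiIndex.degree_add_single, pow_succ, totalD_add_single]
  · simp

theorem partialEulerCoeff_add_of_notMem {A : Finset (Fin n)} {a : Fin n} (ha : a ∉ A) (i : Fin m)
    (K : MultiIndex n) (p : Fin m × MultiIndex n) :
    (partialEulerCoeff A i (K + Finsupp.single a 1) (p.1, p.2 + Finsupp.single a 1) :
      Module.End ℝ (LocalFn n m)) = partialEulerCoeff A i K p := by
  have h2 : (p.2 + Finsupp.single a 1).filter (· ∈ A) = p.2.filter (· ∈ A) := by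
    rw [Finsupp.filter_add, Finsupp.filter_single_of_neg _ ha, add_zero]
  unfold partialEulerCoeff
  simp only [h2, Finsupp.add_apply, add_left_inj]

theorem map_sumPartials {T T' : Fin m × MultiIndex n → Module.End ℝ (LocalFn n m)}
    {G : Module.End ℝ (LocalFn n m)} (h : ∀ p f, T' p f = G (T p f)) (f : LocalFn n m) :
    sumPartials T' f = G (sumPartials T f) := by
  obtain ⟨s, hs⟩ := exists_finset_pderiv_inr f
  rw [sumPartials_eq_sum _ f hs, sumPartials_eq_sum _ f hs, map_sum]
  exact Finset.sum_congr rfl fun p _ => h p _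

/-- Euler operators annihilate divergences. -/
theorem partialEuler_totalDeriv_of_mem {A : Finset (Fin n)} {μ : Fin n} (hμ : μ ∈ A) (i : Fin m)
    (K : MultiIndex n) (f : LocalFn n m) : partialEuler A i K (totalDeriv μ f) = 0 := by
  rw [partialEuler, sumPartials_totalDeriv, map_sumPartials (T := 1) (G := 0)]
  · simp
  · intro p f
    simp [partialEulerCoeff_totalDeriv, partialEulerCoeff_add_of_mem hμ]

theorem partialEuler_totalDeriv_of_notMem {A : Finset (Fin n)} {a : Fin n} (ha : a ∉ A)
    (i : Fin m) (K : MultiIndex n) (f : LocalFn n m) :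
    partialEuler A i (K + Finsupp.single a 1) (totalDeriv a f) =
      totalDeriv a (partialEuler A i (K + Finsupp.single a 1) f) + partialEuler A i K f := by
  rw [partialEuler, sumPartials_totalDeriv]
  obtain ⟨s, hs⟩ := exists_finset_pderiv_inr f
  rw [partialEuler, sumPartials_eq_sum _ f hs, sumPartials_eq_sum _ f hs, sumPartials_eq_sum _ f hs,
    map_sum, ← Finset.sum_add_distrib]
  refine Finset.sum_congr rfl fun p _ => ?_
  simp [partialEulerCoeff_totalDeriv, partialEulerCoeff_add_of_notMem ha]

/-- If `∂_a f` is a divergence along directions other than `a`, then the Euler operators along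
those directions annihilate `f`: by `partialEuler_totalDeriv_of_notMem` each of them equals, up to
sign, a total derivative of the one with `K` raised by `a`, and these vanish eventually because `f`
has finite order. -/
theorem partialEuler_eq_zero_of_totalDeriv {A : Finset (Fin n)} {a : Fin n} (ha : a ∉ A)
    {f : LocalFn n m} (hf : totalDeriv a f ∈ divergences ⊤ A) (i : Fin m) (K : MultiIndex n) :
    partialEuler A i K f = 0 := by
  have h0 : ∀ K, partialEuler A i K (totalDeriv a f) = 0 := by
    intro K
    obtain ⟨h, _, hh⟩ := hf
    rw [hh, map_sum]
    exact Finset.sum_eq_zero fun μ hμ => partialEuler_totalDeriv_of_mem hμ i K _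
  obtain ⟨s, hs⟩ := exists_finset_pderiv_inr f
  obtain ⟨b, hb⟩ := (s.image fun p => p.2 a).exists_nat_subset_range
  have h1 : ∀ K : MultiIndex n, b ≤ K a → partialEuler A i K f = 0 := by
    intro K hK
    rw [partialEuler, sumPartials_eq_sum _ f hs]
    refine Finset.sum_eq_zero fun p hp => ?_
    have hp' : p.2 a < b := Finset.mem_range.1 (hb (Finset.mem_image_of_mem _ hp))
    rw [partialEulerCoeff, if_neg, LinearMap.zero_apply]
    rintro ⟨-, h⟩
    have := h a ha
    omega
  have h2 : ∀ (d : ℕ) (K : MultiIndex n), b ≤ K a + d → partialEuler A i K f = 0 := by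
    intro d
    induction d with
    | zero => exact h1
    | succ d ih =>
      intro K hK
      have h3 := partialEuler_totalDeriv_of_notMem ha i K f
      rw [h0, ih (K + Finsupp.single a 1) (by simp; omega), map_zero, zero_add] at h3
      exact h3.symm
  exact h2 b K (by omega)

/-- A function of the base coordinates is a total derivative in any direction. -/
theorem totalDeriv_primitive (a : Fin n) {f : LocalFn n m}
    (hf : ∀ p, pderiv (Sum.inr p) f = 0) :
    totalDeriv a (coord (Sum.inl a) * scaleInt {Sum.inl a} 0 f) = f := by
  rw [totalDeriv_eq_add_sum a _ (s := ∅), Finset.sum_empty, add_zero, pderiv_coord_mul_scaleInt]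
  intro p _
  rw [pderiv_mul, pderiv_scaleInt_eq_zero (by simp) _ (hf p), pderiv_coord]
  simp

/-- Exactness at the top degree: a local function annihilated by the Euler operators along a
nonempty set of directions is a divergence along these directions. -/
theorem mem_divergences_of_partialEuler {A : Finset (Fin n)} {a : Fin n} (ha : a ∈ A)
    {f : LocalFn n m} (hf : ∀ i K, partialEuler A i K f = 0) : f ∈ divergences ⊤ A := by
  classical
  obtain ⟨s, hs⟩ := exists_finset_pderiv_inr f
  have h1 := eq_restrictZero_add_sum (Set.range Sum.inr) f
    (s := s.map Function.Embedding.inr) (by simp) (by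
      rintro _ ⟨p, rfl⟩ hp
      exact hs p fun h => hp (by simpa using h))
  rw [Finset.sum_map] at h1
  have h2 : restrictZero (Set.range Sum.inr) f ∈ divergences ⊤ A := by
    rw [← totalDeriv_primitive a fun p => pderiv_restrictZero (Set.mem_range_self p) f]
    exact totalDeriv_mem_divergences ha trivial
  rw [h1]
  refine add_mem h2 ?_
  -- Each `φ_p` is a derivative along `A` of the coordinate `φ_{e p}`, `e p` having no `A` part.
  let e : Fin m × MultiIndex n → Fin m × MultiIndex n := fun p => (p.1, p.2.filter (· ∉ A))
  let B : Fin m × MultiIndex n → LocalFn n m := fun p =>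
    coord (Sum.inr (e p)) * partialEulerCoeff A (e p).1 (e p).2 p (fibreInt (pderiv (Sum.inr p) f))
  have h3 : ∀ p, coord (Sum.inr p) * fibreInt (pderiv (Sum.inr p) f) - B p ∈
      divergences ⊤ A := by
    intro p
    have h4 := mul_totalD_sub_mem (J := ⊤) (fun _ _ _ => trivial) (A := A) (p.2.filter (· ∈ A))
      (fun ν hν => Finsupp.filter_apply_neg _ _ hν) (fibreInt (pderiv (Sum.inr p) f))
      (b := coord (Sum.inr (e p))) trivial
    rw [totalD_coord] at h4
    have h5 : (e p).2 + p.2.filter (· ∈ A) = p.2 := by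
      rw [add_comm]; exact Finsupp.filter_add_filter_not _ _
    have h6 : (partialEulerCoeff A (e p).1 (e p).2 p : Module.End ℝ (LocalFn n m)) =
        (-1 : ℝ) ^ (p.2.filter (· ∈ A)).degree • totalD (p.2.filter (· ∈ A)) := by
      rw [partialEulerCoeff, if_pos]
      exact ⟨rfl, fun ν hν => (Finsupp.filter_apply_pos (· ∉ A) p.2 hν).symm⟩
    rw [h5] at h4
    simp only [B, h6]
    convert! h4 using 1
    rw [LinearMap.smul_apply, mul_smul_comm, mul_comm, mul_comm (coord _) (totalD _ _)]
  have h7 : ∑ p ∈ s, B p = 0 := by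
    rw [← Finset.sum_fiberwise_of_maps_to (g := e) (t := s.image e)
      fun p hp => Finset.mem_image_of_mem e hp]
    refine Finset.sum_eq_zero fun q hq => ?_
    obtain ⟨p₀, -, rfl⟩ := Finset.mem_image.1 hq
    have h8 : ∑ p ∈ s with e p = e p₀, B p = coord (Sum.inr (e p₀)) *
        fibreInt (partialEuler A (e p₀).1 (e p₀).2 f) := by
      rw [partialEuler, sumPartials_eq_sum _ f hs, map_sum, Finset.mul_sum, Finset.sum_filter]
      refine Finset.sum_congr rfl fun p _ => ?_
      split_ifs with h
      · simp only [B, h]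
        congr 1
        unfold partialEulerCoeff
        split_ifs
        · simp [totalD_map_comm (G := fibreInt) totalDeriv_fibreInt]
        · simp
      · rw [partialEulerCoeff, if_neg, LinearMap.zero_apply, map_zero, mul_zero]
        rintro ⟨h9, h10⟩
        refine h (Prod.ext h9 (Finsupp.ext fun ν => ?_))
        by_cases hν : ν ∈ A
        · simp [e, hν]
        · have := h10 ν hν
          simpa [e, hν] using this
    rw [h8, hf, map_zero, mul_zero]
  have h11 := sum_mem fun p (_ : p ∈ s) => h3 p
  rw [Finset.sum_sub_distrib, h7, sub_zero] at h11
  exact h11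

/-! ### The algebraic Poincaré lemma in degree `n - 1` -/

theorem totalDeriv_eq_zero_of_pderiv {f : LocalFn n m} (hf : ∀ p, pderiv (Sum.inr p) f = 0)
    {μ : Fin n} (hμ : pderiv (Sum.inl μ) f = 0) : totalDeriv μ f = 0 := by
  rw [totalDeriv_eq_add_sum μ f (s := ∅) fun p _ => hf p, hμ, Finset.sum_empty, add_zero]

theorem pderiv_inr_eq_zero_of_totalDeriv {a : Fin n} {f : LocalFn n m}
    (hf : totalDeriv a f = 0) (p : Fin m × MultiIndex n) : pderiv (Sum.inr p) f = 0 := by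
  have h := partialEuler_eq_zero_of_totalDeriv (A := ∅) (Finset.notMem_empty a)
    (f := f) (by rw [hf]; exact zero_mem _) p.1 p.2
  obtain ⟨s, hs⟩ := exists_finset_pderiv_inr f
  by_cases hp : p ∈ s
  · rw [partialEuler, sumPartials_eq_sum _ f hs, Finset.sum_eq_single p] at h
    · have h0 : p.2.filter (· ∈ (∅ : Finset (Fin n))) = 0 := Finsupp.ext fun ν => by simp
      rw [partialEulerCoeff, if_pos ⟨rfl, fun _ _ => rfl⟩, h0, totalD_zero] at h
      simpa using h
    · intro q _ hq
      rw [partialEulerCoeff, if_neg, LinearMap.zero_apply]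
      rintro ⟨h1, h2⟩
      exact hq (Prod.ext h1 (Finsupp.ext fun ν => h2 ν (Finset.notMem_empty ν)))
    · exact fun h => absurd hp h
  · exact hs p hp

/-- A vector `j` with vanishing divergence along a nonempty set `A` of directions is the divergence
of an antisymmetric array, up to functions of the `x^ν` with `ν ∉ A` that are needed only if `A` is a
singleton. Adding a direction `a` to `A`, the component `j^a` is a divergence along `A` by the Euler
operators, and removing it reduces the claim to `A`. -/
theorem exists_antisymm_of_divergence_eq_zero {A : Finset (Fin n)} (hA : A.Nonempty) :
    ∀ j : Fin n → LocalFn n m, ∑ μ ∈ A, totalDeriv μ (j μ) = 0 →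
      ∃ (η : Fin n → Fin n → LocalFn n m) (c : Fin n → LocalFn n m),
        (∀ μ ν, η μ ν = -η ν μ) ∧ (A.card ≠ 1 → c = 0) ∧
        (∀ μ p, pderiv (Sum.inr p) (c μ) = 0) ∧
        (∀ μ, ∀ ν ∈ A, pderiv (Sum.inl ν) (c μ) = 0) ∧
        ∀ μ ∈ A, j μ = ∑ ν ∈ A, totalDeriv ν (η ν μ) + c μ := by
  classical
  induction hA using Finset.Nonempty.cons_induction with
  | singleton a =>
    intro j hj
    rw [Finset.sum_singleton] at hj
    have h1 := pderiv_inr_eq_zero_of_totalDeriv hj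
    refine ⟨0, fun _ => j a, by simp, by simp, fun _ => h1, fun _ ν hν => ?_, fun μ hμ => ?_⟩
    · rw [Finset.mem_singleton.1 hν]
      rwa [totalDeriv_eq_add_sum a _ (s := ∅) (fun p _ => h1 p), Finset.sum_empty, add_zero] at hj
    · rw [Finset.mem_singleton.1 hμ]; simp
  | cons a A ha hA ih =>
    intro j hj
    rw [Finset.sum_cons] at hj
    obtain ⟨b, hb⟩ := hA
    have h1 : totalDeriv a (j a) ∈ divergences ⊤ A := by
      rw [eq_neg_of_add_eq_zero_left hj]
      exact neg_mem ⟨j, fun _ => trivial, rfl⟩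
    obtain ⟨h, -, hh⟩ := mem_divergences_of_partialEuler hb
      (partialEuler_eq_zero_of_totalDeriv ha h1)
    obtain ⟨η, c, hη, -, hc, hc', hjη⟩ := ih (fun μ => j μ + totalDeriv a (h μ)) (by
      simp only [map_add, Finset.sum_add_distrib]
      rw [← hj, hh, map_sum, add_comm]
      simp only [totalDeriv_comm a])
    let F : Fin n → LocalFn n m := fun μ => coord (Sum.inl a) * scaleInt {Sum.inl a} 0 (c μ)
    have hF : ∀ μ, totalDeriv a (F μ) = c μ := fun μ => totalDeriv_primitive a (hc μ)
    have hF' : ∀ μ, ∀ ν ∈ A, totalDeriv ν (F μ) = 0 := by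
      intro μ ν hν
      have hνa : (Sum.inl ν : Coord n m) ≠ Sum.inl a := fun e => ha (Sum.inl_injective e ▸ hν)
      apply totalDeriv_eq_zero_of_pderiv
      · intro p
        rw [pderiv_mul, pderiv_scaleInt_eq_zero (by simp) _ (hc μ p), pderiv_coord]
        simp
      · rw [pderiv_mul, pderiv_scaleInt_eq_zero (by simpa using hνa) _ (hc' μ ν hν),
          pderiv_coord, if_neg hνa]
        simp
    refine ⟨fun ν μ => if ν = a then (if μ = a then 0 else F μ - h μ) else
      if μ = a then h ν - F ν else η ν μ, 0, fun ν μ => ?_, fun _ => rfl, by simp, by simp,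
      fun μ hμ => ?_⟩
    · by_cases h1 : ν = a <;> by_cases h2 : μ = a <;> simp [h1, h2, hη ν μ]
    · have hne : ∀ ν ∈ A, ν ≠ a := fun ν hν e => ha (e ▸ hν)
      rw [Finset.sum_cons]
      rcases Finset.mem_cons.1 hμ with rfl | hμ
      · simp only [if_true, map_zero, zero_add, Pi.zero_apply, add_zero]
        rw [hh]
        refine Finset.sum_congr rfl fun ν hν => ?_
        rw [if_neg (hne ν hν), map_sub, hF' ν ν hν, sub_zero]
      · have h2 := hjη μ hμ
        have h3 : ∑ ν ∈ A, totalDeriv ν (if ν = a then F μ - h μ else η ν μ) =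
            ∑ ν ∈ A, totalDeriv ν (η ν μ) :=
          Finset.sum_congr rfl fun ν hν => by rw [if_neg (hne ν hν)]
        simp only [if_true, if_neg (hne μ hμ), h3, map_sub, hF, Pi.zero_apply, add_zero]
        rw [eq_sub_of_add_eq h2]
        ring

/-! ### Currents as horizontal forms -/

theorem dH_apply (θ : HForm n m) (S : Finset (Fin n)) :
    dH θ S = ∑ μ ∈ S, (-1 : ℝ) ^ (S.filter (· < μ)).card • totalDeriv μ (θ (S.erase μ)) := rfl

/-- The sign of `dx^μ dx^{S \ μ} = ± dx^S`. -/
def formSign (S : Finset (Fin n)) (μ : Fin n) : ℝ := (-1) ^ (S.filter (· < μ)).card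

theorem formSign_mul_self (S : Finset (Fin n)) (μ : Fin n) :
    formSign S μ * formSign S μ = 1 := by
  rw [formSign, ← pow_add, ← two_mul, pow_mul]
  simp

theorem card_filter_erase {S : Finset (Fin n)} {μ : Fin n} (hμ : μ ∈ S) (ν : Fin n) :
    ((S.erase μ).filter (· < ν)).card + (if μ < ν then 1 else 0) = (S.filter (· < ν)).card := by
  rw [Finset.filter_erase]
  split_ifs with h
  · exact Finset.card_erase_add_one (Finset.mem_filter.2 ⟨hμ, h⟩)
  · rw [Finset.erase_eq_of_notMem, add_zero]
    exact fun h' => h (Finset.mem_filter.1 h').2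

/-- `dx^μ dx^ν = -dx^ν dx^μ`. -/
theorem formSign_mul_formSign_erase {S : Finset (Fin n)} {μ ν : Fin n} (hμ : μ ∈ S) (hν : ν ∈ S)
    (h : μ ≠ ν) :
    formSign S μ * formSign (S.erase μ) ν = -(formSign S ν * formSign (S.erase ν) μ) := by
  unfold formSign
  rw [← card_filter_erase hμ ν, ← card_filter_erase hν μ]
  rcases lt_or_gt_of_ne h with h | h
  · rw [if_pos h, if_neg h.not_gt, pow_succ]; ring
  · rw [if_neg h.not_gt, if_pos h, pow_succ]; ring

theorem LocalFn.eq_zero_of_eq_neg {f : LocalFn n m} (h : f = -f) : f = 0 := by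
  refine LocalFn.ext fun z => ?_
  have h1 : f.eval z + f.eval z = 0 := by
    rw [← eval_add, eq_neg_iff_add_eq_zero.1 h, eval_zero]
  rw [eval_zero]
  linarith

theorem sum_sum_eq_zero_of_antisymm {ι : Type*} (s : Finset ι) {g : ι → ι → LocalFn n m}
    (hg : ∀ a ∈ s, ∀ b ∈ s, g a b = -g b a) : ∑ a ∈ s, ∑ b ∈ s, g a b = 0 := by
  apply LocalFn.eq_zero_of_eq_neg
  conv_rhs => rw [Finset.sum_comm]
  simp only [← Finset.sum_neg_distrib]
  exact Finset.sum_congr rfl fun a ha => Finset.sum_congr rfl fun b hb => hg a ha b hb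

theorem dH_dH (θ : HForm n m) : dH (dH θ) = 0 := by
  funext S
  have h1 : dH (dH θ) S = ∑ μ ∈ S, ∑ ν ∈ S, if μ = ν then 0 else
      (formSign S μ * formSign (S.erase μ) ν) •
        totalDeriv μ (totalDeriv ν (θ ((S.erase μ).erase ν))) := by
    rw [dH_apply]
    refine Finset.sum_congr rfl fun μ hμ => ?_
    rw [dH_apply, map_sum, Finset.smul_sum, ← Finset.add_sum_erase S _ hμ, if_pos rfl, zero_add]
    refine Finset.sum_congr rfl fun ν hν => ?_
    rw [if_neg (Finset.ne_of_mem_erase hν).symm, map_smul, smul_smul]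
    rfl
  rw [h1]
  refine sum_sum_eq_zero_of_antisymm S fun μ hμ ν hν => ?_
  by_cases h : μ = ν
  · simp [h]
  · rw [if_neg h, if_neg (Ne.symm h), formSign_mul_formSign_erase hμ hν h, totalDeriv_comm,
      Finset.erase_right_comm, neg_smul]

theorem dH_mem_degree {p q : ℤ} (hpq : p + 1 = q) {θ : HForm n m} (hθ : θ ∈ HForm.degree n m p) :
    dH θ ∈ HForm.degree n m q := by
  intro S hS
  rw [dH_apply]
  refine Finset.sum_eq_zero fun μ hμ => ?_
  rw [hθ, map_zero, smul_zero]
  have := Finset.card_erase_add_one hμ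
  omega

/-- The `(n-1)`-form of a vector `j^μ` of local functions. -/
def current (j : Fin n → LocalFn n m) : HForm n m :=
  fun S => ∑ μ, if S = Finset.univ.erase μ then formSign Finset.univ μ • j μ else 0

theorem current_apply_erase (j : Fin n → LocalFn n m) (μ : Fin n) :
    current j (Finset.univ.erase μ) = formSign Finset.univ μ • j μ := by
  rw [current, Finset.sum_eq_single μ]
  · simp
  · intro ν _ hν
    rw [if_neg]
    intro h
    have : ν ∈ Finset.univ.erase μ := Finset.mem_erase.2 ⟨hν, Finset.mem_univ _⟩
    rw [h] at this
    simp at this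
  · simp

theorem current_mem_degree (j : Fin n → LocalFn n m) :
    current j ∈ HForm.degree n m ((n : ℤ) - 1) := by
  intro S hS
  refine Finset.sum_eq_zero fun μ _ => if_neg ?_
  rintro rfl
  have := Finset.card_erase_add_one (Finset.mem_univ μ)
  rw [Finset.card_univ, Fintype.card_fin] at this
  omega

theorem exists_eq_univ_erase {S : Finset (Fin n)} (hS : (S.card : ℤ) = (n : ℤ) - 1) :
    ∃ μ, S = Finset.univ.erase μ := by
  have h1 : Sᶜ.card = 1 := by
    rw [Finset.card_compl, Fintype.card_fin]
    omega
  obtain ⟨μ, hμ⟩ := Finset.card_eq_one.1 h1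
  refine ⟨μ, ?_⟩
  rw [← compl_compl S, hμ]
  ext ν
  simp

theorem HForm.ext_of_mem_degree {θ η : HForm n m} (hθ : θ ∈ HForm.degree n m ((n : ℤ) - 1))
    (hη : η ∈ HForm.degree n m ((n : ℤ) - 1))
    (h : ∀ μ, θ (Finset.univ.erase μ) = η (Finset.univ.erase μ)) : θ = η := by
  funext S
  by_cases hS : (S.card : ℤ) = (n : ℤ) - 1
  · obtain ⟨μ, rfl⟩ := exists_eq_univ_erase hS
    exact h μ
  · rw [hθ S hS, hη S hS]

theorem exists_eq_current {θ : HForm n m} (hθ : θ ∈ HForm.degree n m ((n : ℤ) - 1)) :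
    θ = current fun μ => formSign Finset.univ μ • θ (Finset.univ.erase μ) := by
  refine HForm.ext_of_mem_degree hθ (current_mem_degree _) fun μ => ?_
  rw [current_apply_erase, smul_smul, formSign_mul_self, one_smul]

theorem dH_current (j : Fin n → LocalFn n m) :
    dH (current j) = topForm (∑ μ, totalDeriv μ (j μ)) := by
  funext S
  by_cases hS : S = Finset.univ
  · subst hS
    rw [dH_apply, topForm, Pi.single_eq_same]
    refine Finset.sum_congr rfl fun μ _ => ?_
    rw [current_apply_erase, map_smul, smul_smul]
    exact (congrArg (· • _) (formSign_mul_self _ μ)).trans (one_smul _ _)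
  · rw [topForm, Pi.single_eq_of_ne hS]
    refine dH_mem_degree (sub_add_cancel (n : ℤ) 1) (current_mem_degree j) S ?_
    intro h
    apply hS
    rw [← Finset.card_eq_iff_eq_univ, Fintype.card_fin]
    exact_mod_cast h

theorem topForm_injective : Function.Injective (topForm : LocalFn n m → HForm n m) :=
  fun _ _ h => Pi.single_injective (M := fun _ : Finset (Fin n) => LocalFn n m) Finset.univ h

open Classical in
/-- The divergence of an antisymmetric array is the differential of an `(n-2)`-form. -/
theorem exists_dH_eq_current {η : Fin n → Fin n → LocalFn n m} (hη : ∀ μ ν, η μ ν = -η ν μ) :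
    ∃ ζ ∈ HForm.degree n m ((n : ℤ) - 2),
      dH ζ = current fun μ => ∑ ν, totalDeriv ν (η ν μ) := by
  let s : Fin n × Fin n → ℝ := fun q =>
    formSign Finset.univ q.1 * formSign (Finset.univ.erase q.1) q.2
  let E : Fin n × Fin n → Finset (Fin n) := fun q => (Finset.univ.erase q.1).erase q.2
  let ζ : HForm n m := fun S => if h : ∃ q : Fin n × Fin n, q.1 ≠ q.2 ∧ S = E q then
    s h.choose • η h.choose.2 h.choose.1 else 0
  -- The two orders of the missing directions give the same component, as signs and array are both
  -- antisymmetric.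
  have hζ : ∀ q : Fin n × Fin n, q.1 ≠ q.2 → ζ (E q) = s q • η q.2 q.1 := by
    intro q hq
    have h : ∃ q' : Fin n × Fin n, q'.1 ≠ q'.2 ∧ E q = E q' := ⟨q, hq, rfl⟩
    have h1 : ζ (E q) = s h.choose • η h.choose.2 h.choose.1 := dif_pos h
    rw [h1]
    obtain ⟨hne, heq⟩ := h.choose_spec
    generalize h.choose = q' at hne heq
    obtain ⟨a, b⟩ := q
    obtain ⟨c, d⟩ := q'
    simp only at hne heq hq
    have hc : c ∉ E (a, b) := by rw [heq]; simp [E]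
    have hd : d ∉ E (a, b) := by rw [heq]; simp [E]
    have hc' : c = a ∨ c = b := by
      simp only [E, Finset.mem_erase, Finset.mem_univ, and_true] at hc; tauto
    have hd' : d = a ∨ d = b := by
      simp only [E, Finset.mem_erase, Finset.mem_univ, and_true] at hd; tauto
    rcases hc' with rfl | rfl <;> rcases hd' with rfl | rfl
    · exact absurd rfl hne
    · rfl
    · simp only [s]
      rw [formSign_mul_formSign_erase (Finset.mem_univ _) (Finset.mem_univ _) hne, hη]
      simp
    · exact absurd rfl hne
  have hdeg : ζ ∈ HForm.degree n m ((n : ℤ) - 2) := by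
    intro S hS
    refine dif_neg ?_
    rintro ⟨q, hq, rfl⟩
    have h1 := Finset.card_erase_add_one (Finset.mem_univ q.1)
    have h2 := Finset.card_erase_add_one (Finset.mem_erase.2 ⟨hq.symm, Finset.mem_univ q.2⟩)
    rw [Finset.card_univ, Fintype.card_fin] at h1
    simp only [E] at hS
    omega
  refine ⟨ζ, hdeg, HForm.ext_of_mem_degree (dH_mem_degree (by ring) hdeg) (current_mem_degree _)
    fun μ => ?_⟩
  have h0 : η μ μ = 0 := LocalFn.eq_zero_of_eq_neg (hη μ μ)
  rw [current_apply_erase, dH_apply, ← Finset.add_sum_erase Finset.univ _ (Finset.mem_univ μ), h0,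
    map_zero, zero_add, Finset.smul_sum]
  refine Finset.sum_congr rfl fun ν hν => ?_
  have h1 : ζ ((Finset.univ.erase μ).erase ν) = _ := hζ (μ, ν) (Finset.ne_of_mem_erase hν).symm
  rw [h1, map_smul, smul_smul]
  congr 1
  change formSign (Finset.univ.erase μ) ν * (formSign Finset.univ μ *
    formSign (Finset.univ.erase μ) ν) = _
  rw [mul_left_comm, formSign_mul_self, mul_one]

/-- The algebraic Poincaré lemma in degree `n - 1`. -/
theorem exists_eq_dH_add_const {θ : HForm n m} (hθ : θ ∈ HForm.degree n m ((n : ℤ) - 1))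
    (hd : dH θ = 0) :
    ∃ (η : HForm n m) (C : ℝ), η ∈ HForm.degree n m ((n : ℤ) - 2) ∧ (n ≠ 1 → C = 0) ∧
      θ = dH η + constForm C := by
  obtain ⟨j, rfl⟩ : ∃ j, θ = current j := ⟨_, exists_eq_current hθ⟩
  rw [dH_current] at hd
  have hj : ∑ μ, totalDeriv μ (j μ) = 0 := topForm_injective (hd.trans (Pi.single_zero _).symm)
  rcases Nat.eq_zero_or_pos n with rfl | hn
  · refine ⟨0, 0, zero_mem _, fun _ => rfl, ?_⟩
    funext S
    simp [current, constForm]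
  · have : Nonempty (Fin n) := ⟨⟨0, hn⟩⟩
    obtain ⟨η, c, hη, hc, hc1, hc2, hjη⟩ :=
      exists_antisymm_of_divergence_eq_zero Finset.univ_nonempty j hj
    obtain ⟨ζ, hζ, hζ'⟩ := exists_dH_eq_current hη
    have hj' : j = fun μ => ∑ ν, totalDeriv ν (η ν μ) + c μ := funext fun μ =>
      hjη μ (Finset.mem_univ μ)
    by_cases h1 : n = 1
    · subst h1
      obtain ⟨C, hC⟩ := eq_algebraMap_of_pderiv_eq_zero (f := c 0) (by
        rintro (ν | p)
        · exact hc2 0 ν (Finset.mem_univ ν)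
        · exact hc1 0 p)
      refine ⟨ζ, C, hζ, fun h => absurd rfl h, ?_⟩
      rw [hζ', hj']
      funext S
      have h2 : Finset.univ.erase (0 : Fin 1) = ∅ := by decide
      simp only [current, Fin.sum_univ_one, Pi.add_apply, constForm, Pi.single_apply, h2, hC]
      split_ifs with h
      · simp [smul_add, formSign]
      · simp
    · rw [Finset.card_univ, Fintype.card_fin] at hc
      refine ⟨ζ, 0, hζ, fun _ => rfl, ?_⟩
      rw [hζ', hj', hc h1]
      simp [constForm]

/-! ### Total differential operators and their adjoints -/

theorem DiffOp.apply_add_left (N N' : DiffOp n m) (f : LocalFn n m) :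
    (N + N').apply f = N.apply f + N'.apply f :=
  Finsupp.sum_add_index' (by simp) (by intros; simp [add_mul])

theorem DiffOp.apply_single (I : MultiIndex n) (a f : LocalFn n m) :
    DiffOp.apply (Finsupp.single I a) f = a * totalD I f :=
  Finsupp.sum_single_index (by simp)

theorem DiffOp.adjointApply_single (I : MultiIndex n) (a f : LocalFn n m) :
    DiffOp.adjointApply (Finsupp.single I a) f = (-1 : ℝ) ^ I.degree • totalD I (a * f) :=
  Finsupp.sum_single_index (by simp)

/-- `DiffOp.apply` as an additive map of the operator. -/
noncomputable def DiffOp.applyHom (f : LocalFn n m) : DiffOp n m →+ LocalFn n m :=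
  AddMonoidHom.mk' (fun N => N.apply f) fun N N' => N.apply_add_left N' f

theorem DiffOp.applyHom_apply (f : LocalFn n m) (N : DiffOp n m) : applyHom f N = N.apply f := rfl

/-- `DiffOp.adjointApply` as an additive map of the operator. -/
noncomputable def DiffOp.adjointHom (f : LocalFn n m) : DiffOp n m →+ LocalFn n m :=
  AddMonoidHom.mk' (fun N => N.adjointApply f) fun N N' => N.adjointApply_add_left N' f

theorem DiffOp.adjointHom_apply (f : LocalFn n m) (N : DiffOp n m) :
    adjointHom f N = N.adjointApply f := rfl

theorem DiffOp.leftD_single (μ : Fin n) (I : MultiIndex n) (a : LocalFn n m) :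
    DiffOp.leftD μ (Finsupp.single I a) =
      Finsupp.single I (totalDeriv μ a) + Finsupp.single (I + Finsupp.single μ 1) a := by
  simp [DiffOp.leftD]

theorem DiffOp.leftD_commute (μ ν : Fin n) :
    Commute (DiffOp.leftD μ : Module.End ℝ (DiffOp n m)) (DiffOp.leftD ν) := by
  refine Finsupp.lhom_ext fun I a => ?_
  simp only [Module.End.mul_apply, leftD_single, map_add]
  rw [totalDeriv_comm, add_right_comm I]
  abel

theorem DiffOp.apply_leftD (μ : Fin n) (N : DiffOp n m) (f : LocalFn n m) :
    (DiffOp.leftD μ N).apply f = totalDeriv μ (N.apply f) := by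
  induction N using Finsupp.induction_linear with
  | zero => simp [DiffOp.apply]
  | add N N' h h' => rw [map_add, apply_add_left, h, h', apply_add_left, map_add]
  | single I a =>
    rw [leftD_single, apply_add_left, apply_single, apply_single, apply_single, totalDeriv_mul,
      totalD_add_single]
    ring

theorem DiffOp.adjointApply_leftD (μ : Fin n) (N : DiffOp n m) (f : LocalFn n m) :
    (DiffOp.leftD μ N).adjointApply f = -N.adjointApply (totalDeriv μ f) := by
  induction N using Finsupp.induction_linear with
  | zero => simp [DiffOp.adjointApply]
  | add N N' h h' => rw [map_add, adjointApply_add_left, h, h', adjointApply_add_left, neg_add]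
  | single I a =>
    rw [leftD_single, adjointApply_add_left, adjointApply_single, adjointApply_single,
      adjointApply_single, totalD_add_single, MultiIndex.degree_add_single, ← totalD_totalDeriv,
      totalDeriv_mul, map_add, mul_comm f, pow_succ, mul_neg_one, neg_smul, smul_add]
    abel

theorem DiffOp.adjointApply_multiPow (I : MultiIndex n) (N : DiffOp n m) (f : LocalFn n m) :
    (multiPow DiffOp.leftD I N).adjointApply f =
      (-1 : ℝ) ^ I.degree • N.adjointApply (totalD I f) := by
  induction I using MultiIndex.induction generalizing f with
  | h0 => simp [multiPow_zero, totalD_zero]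
  | hs I μ ih =>
    rw [multiPow_add_single leftD_commute, Module.End.mul_apply, adjointApply_leftD, ih,
      totalD_totalDeriv, totalD_add_single, MultiIndex.degree_add_single, pow_succ, mul_neg_one,
      neg_smul]

theorem DiffOp.adjointApply_coeff_smul (a : LocalFn n m) (N : DiffOp n m) (f : LocalFn n m) :
    (a • N).adjointApply f = N.adjointApply (a * f) := by
  induction N using Finsupp.induction_linear with
  | zero => simp [DiffOp.adjointApply]
  | add N N' h h' => rw [smul_add, adjointApply_add_left, h, h', adjointApply_add_left]
  | single I b =>
    rw [Finsupp.smul_single, adjointApply_single, adjointApply_single, smul_eq_mul, mul_left_comm,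
      mul_assoc]

/-- The adjoint of a composition is the composition of the adjoints in the opposite order. -/
theorem DiffOp.adjointApply_comp (Z N : DiffOp n m) (f : LocalFn n m) :
    (Z.comp N).adjointApply f = N.adjointApply (Z.adjointApply f) := by
  induction Z using Finsupp.induction_linear with
  | zero => simp [DiffOp.adjointApply, DiffOp.comp]
  | add Z Z' h h' =>
    have h1 : DiffOp.comp (Z + Z') N = DiffOp.comp Z N + DiffOp.comp Z' N :=
      Finsupp.sum_add_index' (by simp) (by intros; simp [add_smul])
    rw [h1, adjointApply_add_left, h, h', adjointApply_add_left, adjointApply_add]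
  | single I a =>
    have h1 : DiffOp.comp (Finsupp.single I a) N = a • multiPow DiffOp.leftD I N :=
      Finsupp.sum_single_index (by simp)
    rw [h1, adjointApply_coeff_smul, adjointApply_multiPow, adjointApply_single, adjointApply_smul]

/-- Integration by parts for a total differential operator. -/
theorem DiffOp.mul_apply_sub_mem {J : Ideal (LocalFn n m)}
    (hJ : ∀ μ, ∀ f ∈ J, totalDeriv μ f ∈ J) (N : DiffOp n m) (f : LocalFn n m) {g : LocalFn n m}
    (hg : g ∈ J) : f * N.apply g - N.adjointApply f * g ∈ divergences J Finset.univ := by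
  induction N using Finsupp.induction_linear with
  | zero => simp [DiffOp.adjointApply, DiffOp.apply]
  | add N N' h h' =>
    rw [apply_add_left, adjointApply_add_left]
    convert! add_mem h h' using 1
    ring
  | single I a =>
    rw [apply_single, adjointApply_single]
    convert! mul_totalD_sub_mem hJ I (fun ν h => absurd (Finset.mem_univ ν) h) (a * f) hg using 1
    rw [smul_mul_assoc]
    ring

/-! ### The ideal of weakly vanishing functions -/

/-- The ideal of the local functions that vanish on the stationary surface. -/
def weakIdeal (L : LocalFn n m) : Ideal (LocalFn n m) where
  carrier := {f | WeaklyZero L f}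
  add_mem' := fun hf hg z hz => by rw [LocalFn.eval_add, hf z hz, hg z hz, add_zero]
  zero_mem' := fun _ _ => rfl
  smul_mem' := fun a f hf z hz => by
    rw [smul_eq_mul, LocalFn.eval_mul, hf z hz, mul_zero]

theorem totalD_eulerLagrange_mem (L : LocalFn n m) (i : Fin m) (I : MultiIndex n) :
    totalD I (eulerLagrange i L) ∈ weakIdeal L := fun _ hz => hz i I

theorem eulerLagrange_mem (L : LocalFn n m) (i : Fin m) : eulerLagrange i L ∈ weakIdeal L := by
  have := totalD_eulerLagrange_mem L i 0
  rwa [totalD_zero] at this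

theorem apply_eulerLagrange_mem (L : LocalFn n m) (N : DiffOp n m) (i : Fin m) :
    N.apply (eulerLagrange i L) ∈ weakIdeal L :=
  sum_mem fun I _ => Ideal.mul_mem_left _ _ (totalD_eulerLagrange_mem L i I)

/-- The total derivatives are tangent to the stationary surface. -/
theorem IsRegular.totalDeriv_mem {L : LocalFn n m} (hL : IsRegular L) (μ : Fin n)
    (f : LocalFn n m) (hf : f ∈ weakIdeal L) : totalDeriv μ f ∈ weakIdeal L := by
  obtain ⟨k, rfl⟩ := hL f hf
  rw [map_sum]
  refine sum_mem fun i _ => ?_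
  rw [← DiffOp.apply_leftD]
  exact apply_eulerLagrange_mem L _ i

theorem divergences_mono {J J' : Ideal (LocalFn n m)} (h : J ≤ J') (A : Finset (Fin n)) :
    divergences J A ≤ divergences J' A := by
  rintro _ ⟨k, hk, rfl⟩
  exact ⟨k, fun μ => h (hk μ), rfl⟩

variable {r : ℕ}

/-! ### Symmetries as characteristics of conservation laws -/

/-- The first variational formula: `δ_Q L` and `Q^i δL/δφ^i` agree up to a divergence. -/
theorem evolutionary_sub_mem (Q : Fin m → LocalFn n m) (L : LocalFn n m) :
    evolutionary Q L - ∑ i, Q i * eulerLagrange i L ∈ divergences ⊤ Finset.univ := by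
  obtain ⟨s, hs⟩ := exists_finset_pderiv_inr L
  have h1 : ∑ i, Q i * eulerLagrange i L =
      ∑ p ∈ s, Q p.1 * ((-1 : ℝ) ^ p.2.degree • totalD p.2 (pderiv (Sum.inr p) L)) := by
    simp only [eulerLagrange, sumPartials_eq_sum _ L hs, Finset.mul_sum]
    rw [Finset.sum_comm]
    refine Finset.sum_congr rfl fun p _ => ?_
    rw [Finset.sum_eq_single p.1]
    · simp
    · intro i _ hi; rw [if_neg (Ne.symm hi)]; simp
    · simp
  rw [h1, evolutionary, sumPartials_eq_sum _ L hs, ← Finset.sum_sub_distrib]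
  refine sum_mem fun p _ => ?_
  convert! mul_totalD_sub_mem (J := ⊤) (fun _ _ _ => trivial) p.2
    (fun ν h => absurd (Finset.mem_univ ν) h) (pderiv (Sum.inr p) L) (b := Q p.1) trivial using 1
  rw [LinearMap.mulLeft_apply, mul_smul_comm, mul_comm, mul_comm (Q p.1)]

theorem mem_variationalSymmetries_iff {L : LocalFn n m} {Q : Fin m → LocalFn n m} :
    Q ∈ variationalSymmetries L ↔
      ∑ i, Q i * eulerLagrange i L ∈ divergences ⊤ Finset.univ := by
  have h1 : Q ∈ variationalSymmetries L ↔ evolutionary Q L ∈ divergences ⊤ Finset.univ :=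
    ⟨fun ⟨k, hk⟩ => ⟨k, fun _ => trivial, hk⟩, fun ⟨k, _, hk⟩ => ⟨k, hk⟩⟩
  rw [h1]
  refine ⟨fun h => ?_, fun h => ?_⟩
  · simpa using sub_mem h (evolutionary_sub_mem Q L)
  · simpa using add_mem (evolutionary_sub_mem Q L) h

theorem sum_onShellOp_apply (L : LocalFn n m) {M : EomArray n m} (hM : M.IsAntisymm) :
    ∑ i, (onShellOp L M i).apply (eulerLagrange i L) = 0 := by
  classical
  let e : Fin m × MultiIndex n → LocalFn n m := fun a => totalD a.2 (eulerLagrange a.1 L)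
  have h1 : ∑ i, (onShellOp L M i).apply (eulerLagrange i L) =
      ∑ p ∈ M.support, M p * e p.1 * e p.2 := by
    simp only [onShellOp, Finsupp.sum, ← DiffOp.applyHom_apply, map_sum]
    rw [Finset.sum_comm]
    refine Finset.sum_congr rfl fun p _ => ?_
    rw [Finset.sum_eq_single p.2.1]
    · rw [if_pos rfl, DiffOp.applyHom_apply, DiffOp.apply_single]
    · intro i _ hi; rw [if_neg (Ne.symm hi), map_zero]
    · simp
  let t := M.support.image Prod.fst ∪ M.support.image Prod.snd
  have h2 : M.support ⊆ t ×ˢ t := fun p hp => Finset.mem_product.2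
    ⟨Finset.mem_union_left _ (Finset.mem_image_of_mem _ hp),
      Finset.mem_union_right _ (Finset.mem_image_of_mem _ hp)⟩
  rw [h1, Finset.sum_subset h2, Finset.sum_product]
  · refine sum_sum_eq_zero_of_antisymm t fun a _ b _ => ?_
    rw [hM a b]
    ring
  · intro p _ hp
    rw [Finsupp.notMem_support_iff.1 hp, zero_mul, zero_mul]

/-- A characteristic `Q` is trivial if and only if `Q^i δL/δφ^i` is the divergence of a weakly
vanishing vector. One direction is integration by parts. For the other one, writing the components
of the vector as `k^{μ i}[δL/δφ^i]` gives the Noether identity with the operators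
`Q^i - ∂_μ ∘ k^{μ i}`, whose adjoints map `1` to `Q^i`. -/
theorem mem_trivialSymmetries_iff {L : LocalFn n m} {R : Fin r → Fin m → DiffOp n m}
    (hL : IsRegular L) (hR : IsIrreducibleGaugeTheory L R) {Q : Fin m → LocalFn n m} :
    Q ∈ trivialSymmetries L R ↔
      ∑ i, Q i * eulerLagrange i L ∈ divergences (weakIdeal L) Finset.univ := by
  constructor
  · rintro ⟨f, M, hM, hQ⟩
    have h1 : ∀ (N : Fin m → DiffOp n m) (g : LocalFn n m),
        ∑ i, (N i).apply (eulerLagrange i L) = 0 →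
          ∑ i, (N i).adjointApply g * eulerLagrange i L ∈
            divergences (weakIdeal L) Finset.univ := by
      intro N g hN
      have h2 := sum_mem fun i (_ : i ∈ Finset.univ) =>
        (N i).mul_apply_sub_mem hL.totalDeriv_mem g (eulerLagrange_mem L i)
      rw [Finset.sum_sub_distrib, ← Finset.mul_sum, hN, mul_zero, zero_sub] at h2
      exact neg_mem_iff.1 h2
    simp only [hQ, add_mul, Finset.sum_add_distrib, Finset.sum_mul]
    refine add_mem ?_ (h1 _ 1 (sum_onShellOp_apply L hM))
    rw [Finset.sum_comm]
    exact sum_mem fun α _ => h1 (R α) (f α) (hR.noether α)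
  · rintro ⟨t, ht, hQ⟩
    choose k hk using fun μ => hL (t μ) (ht μ)
    obtain ⟨Z, M, hM, hN⟩ := hR.generating
      (fun i => Finsupp.single 0 (Q i) - ∑ μ, DiffOp.leftD μ (k μ i)) (by
        have h1 : ∀ i, DiffOp.apply (Finsupp.single 0 (Q i) - ∑ μ, DiffOp.leftD μ (k μ i))
            (eulerLagrange i L) = Q i * eulerLagrange i L -
              ∑ μ, totalDeriv μ ((k μ i).apply (eulerLagrange i L)) := by
          intro i
          rw [← DiffOp.applyHom_apply, map_sub, map_sum, DiffOp.applyHom_apply,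
            DiffOp.apply_single, totalD_zero]
          simp only [DiffOp.applyHom_apply, DiffOp.apply_leftD]
          rfl
        unfold IsNoetherIdentity
        simp only [h1]
        rw [Finset.sum_sub_distrib, hQ, Finset.sum_comm, sub_eq_zero]
        refine Finset.sum_congr rfl fun μ _ => ?_
        rw [hk μ, map_sum])
    refine ⟨fun α => (Z α).adjointApply 1, M, hM, fun i => ?_⟩
    have h2 := congrArg (DiffOp.adjointHom 1) (hN i)
    rw [map_sub, map_sum, map_add, map_sum] at h2
    simp only [DiffOp.adjointHom_apply, DiffOp.adjointApply_single, DiffOp.adjointApply_leftD,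
      DiffOp.adjointApply_comp, totalDeriv_one, totalD_zero] at h2
    have h3 : ∀ μ, (k μ i).adjointApply 0 = 0 := fun μ => by simp [DiffOp.adjointApply]
    simpa [h3] using h2

/-! ### Noether currents -/

theorem exists_isNoetherCurrent {L : LocalFn n m} {Q : Fin m → LocalFn n m}
    (hQ : Q ∈ variationalSymmetries L) :
    ∃ j ∈ conservedCurrents L, IsNoetherCurrent L Q j := by
  obtain ⟨k, -, hk⟩ := mem_variationalSymmetries_iff.1 hQ
  have h1 : IsNoetherCurrent L Q (current k) := by rw [IsNoetherCurrent, dH_current, hk]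
  refine ⟨current k, ⟨current_mem_degree k, fun S => ?_⟩, h1⟩
  rw [h1, topForm, Pi.single_apply]
  split_ifs
  · exact sum_mem (S := weakIdeal L) fun i _ => Ideal.mul_mem_left _ _ (eulerLagrange_mem L i)
  · exact (weakIdeal L).zero_mem

theorem weaklyZero_current {L : LocalFn n m} {k : Fin n → LocalFn n m}
    (hk : ∀ μ, k μ ∈ weakIdeal L) : HForm.WeaklyZero L (current k) := by
  intro S
  refine sum_mem (S := weakIdeal L) fun μ _ => ?_
  split_ifs
  · exact Submodule.smul_of_tower_mem _ _ (hk μ)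
  · exact zero_mem _

/-- Integrating by parts the expression of `d_H j` through the equations of motion, a conserved
current becomes a Noether current after the addition of a weakly vanishing one. -/
theorem exists_isNoetherCurrent_sub {L : LocalFn n m} (hL : IsRegular L) {j : HForm n m}
    (hj : j ∈ conservedCurrents L) :
    ∃ Q ∈ variationalSymmetries L, ∃ t : Fin n → LocalFn n m, (∀ μ, t μ ∈ weakIdeal L) ∧
      IsNoetherCurrent L Q (j - current t) := by
  obtain ⟨h, rfl⟩ : ∃ h, j = current h := ⟨_, exists_eq_current hj.1⟩
  have h1 := hj.2 Finset.univ
  rw [dH_current, topForm, Pi.single_eq_same] at h1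
  obtain ⟨k, hk⟩ := hL _ h1
  have h2 := sum_mem fun i (_ : i ∈ Finset.univ) =>
    (k i).mul_apply_sub_mem hL.totalDeriv_mem 1 (eulerLagrange_mem L i)
  simp only [one_mul] at h2
  rw [Finset.sum_sub_distrib, ← hk] at h2
  obtain ⟨t, ht, h3⟩ := h2
  have h4 : ∑ i, (k i).adjointApply 1 * eulerLagrange i L =
      ∑ μ, totalDeriv μ (h μ) - ∑ μ, totalDeriv μ (t μ) := by
    rw [← h3]; ring
  refine ⟨fun i => (k i).adjointApply 1, mem_variationalSymmetries_iff.2 ?_, t, ht, ?_⟩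
  · rw [h4, ← Finset.sum_sub_distrib]
    exact ⟨h - t, fun _ => trivial, by simp⟩
  · rw [IsNoetherCurrent, map_sub, dH_current, dH_current, h4]
    exact (Pi.single_sub _ _ _).symm

theorem dH_constForm (C : ℝ) : dH (constForm C : HForm n m) = 0 := by
  funext S
  rw [dH_apply]
  refine Finset.sum_eq_zero fun μ _ => ?_
  rw [constForm, Pi.single_apply]
  split_ifs
  · rw [Algebra.algebraMap_eq_smul_one, map_smul, totalDeriv_one, smul_zero, smul_zero]
  · rw [map_zero, smul_zero]

theorem dH_trivialCurrent (t η : HForm n m) (C : ℝ) : dH (t + dH η + constForm C) = dH t := by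
  rw [map_add, map_add, dH_dH, dH_constForm, add_zero, add_zero]

theorem constForm_mem_degree {C : ℝ} (hC : n ≠ 1 → C = 0) :
    (constForm C : HForm n m) ∈ HForm.degree n m ((n : ℤ) - 1) := by
  intro S hS
  rw [constForm, Pi.single_apply]
  split_ifs with h
  · rw [hC, map_zero]
    rintro rfl
    simp [h] at hS
  · rfl

theorem trivialCurrents_le {L : LocalFn n m} (hL : IsRegular L) :
    trivialCurrents L ≤ conservedCurrents L := by
  rintro _ ⟨t, η, C, ht, ht0, hη, hC, rfl⟩
  refine ⟨add_mem (add_mem ht (dH_mem_degree (by ring) hη)) (constForm_mem_degree hC), ?_⟩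
  rw [dH_trivialCurrent]
  intro S
  rw [dH_apply]
  exact sum_mem (S := weakIdeal L) fun μ _ =>
    Submodule.smul_of_tower_mem _ _ (hL.totalDeriv_mem μ _ (ht0 _))

/-- A Noether current is trivial if and only if its characteristic is. -/
theorem mem_trivialSymmetries_iff_mem_trivialCurrents {L : LocalFn n m}
    {R : Fin r → Fin m → DiffOp n m} (hL : IsRegular L) (hR : IsIrreducibleGaugeTheory L R)
    {Q : Fin m → LocalFn n m} {j : HForm n m} (hj : j ∈ conservedCurrents L)
    (h : IsNoetherCurrent L Q j) :
    Q ∈ trivialSymmetries L R ↔ j ∈ trivialCurrents L := by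
  rw [mem_trivialSymmetries_iff hL hR]
  constructor
  · rintro ⟨t, ht, hQ⟩
    have h1 : dH (j - current t) = 0 := by
      rw [map_sub, h, dH_current, hQ, sub_self]
    obtain ⟨η, C, hη, hC, h2⟩ :=
      exists_eq_dH_add_const (sub_mem hj.1 (current_mem_degree t)) h1
    exact ⟨current t, η, C, current_mem_degree t, weaklyZero_current ht, hη, hC, by
      rw [add_assoc, ← h2]; abel⟩
  · rintro ⟨t, η, C, ht, ht0, -, -, rfl⟩
    rw [IsNoetherCurrent, dH_trivialCurrent, exists_eq_current ht, dH_current] at h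
    rw [← topForm_injective h]
    exact ⟨_, fun μ => Submodule.smul_of_tower_mem _ _ (ht0 _), rfl⟩

/-- The pairs of a variational symmetry and a Noether current of it. -/
def noetherPairs (L : LocalFn n m) :
    Submodule ℝ (variationalSymmetries L × conservedCurrents L) where
  carrier := {q | IsNoetherCurrent L q.1.1 q.2.1}
  add_mem' := by
    intro q q' h h'
    have h1 : dH (q.2.1 + q'.2.1) = topForm (∑ i, (q.1.1 i + q'.1.1 i) * eulerLagrange i L) := by
      rw [map_add, h, h']
      simp only [add_mul, Finset.sum_add_distrib]
      exact (Pi.single_add _ _ _).symm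
    exact h1
  zero_mem' := by
    have h1 : dH (0 : HForm n m) = topForm (∑ i, (0 : LocalFn n m) * eulerLagrange i L) := by
      simp [topForm]
    exact h1
  smul_mem' := by
    intro a q h
    have h1 : dH (a • q.2.1) = topForm (∑ i, (a • q.1.1 i) * eulerLagrange i L) := by
      rw [map_smul, h]
      simp only [smul_mul_assoc, ← Finset.smul_sum]
      exact (Pi.single_smul _ _ _).symm
    exact h1

/-! ### Isomorphisms of quotients from linear relations -/

/-- A linear relation between `V` and `W` that is total, onto modulo `T`, and relates the elements of
`S` exactly to those of `T`, induces an isomorphism `V ⧸ S ≃ W ⧸ T`: both quotients are quotients of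
the relation by the same kernel. -/
theorem exists_quotientEquiv_of_relation {V W : Type*} [AddCommGroup V] [Module ℝ V]
    [AddCommGroup W] [Module ℝ W] (S : Submodule ℝ V) (T : Submodule ℝ W)
    (G : Submodule ℝ (V × W)) (h₁ : ∀ v, ∃ w, (v, w) ∈ G)
    (h₂ : ∀ w, ∃ v w', (v, w') ∈ G ∧ w' - w ∈ T) (h : ∀ v w, (v, w) ∈ G → (v ∈ S ↔ w ∈ T)) :
    ∃ Φ : (V ⧸ S) ≃ₗ[ℝ] (W ⧸ T), ∀ v w, (v, w) ∈ G →
      Φ (Submodule.Quotient.mk v) = Submodule.Quotient.mk w := by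
  let p₁ : G →ₗ[ℝ] V ⧸ S := S.mkQ ∘ₗ LinearMap.fst ℝ V W ∘ₗ G.subtype
  let p₂ : G →ₗ[ℝ] W ⧸ T := T.mkQ ∘ₗ LinearMap.snd ℝ V W ∘ₗ G.subtype
  have hp₁ : Function.Surjective p₁ := by
    intro x
    obtain ⟨v, rfl⟩ := Submodule.Quotient.mk_surjective _ x
    obtain ⟨w, hw⟩ := h₁ v
    exact ⟨⟨(v, w), hw⟩, rfl⟩
  have hp₂ : Function.Surjective p₂ := by
    intro x
    obtain ⟨w, rfl⟩ := Submodule.Quotient.mk_surjective _ x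
    obtain ⟨v, w', hw, hT⟩ := h₂ w
    exact ⟨⟨(v, w'), hw⟩, (Submodule.Quotient.eq _).2 hT⟩
  have hker : LinearMap.ker p₁ = LinearMap.ker p₂ := by
    ext ⟨⟨v, w⟩, hvw⟩
    rw [LinearMap.mem_ker, LinearMap.mem_ker]
    exact (Submodule.Quotient.mk_eq_zero _).trans
      ((h v w hvw).trans (Submodule.Quotient.mk_eq_zero _).symm)
  refine ⟨(p₁.quotKerEquivOfSurjective hp₁).symm ≪≫ₗ Submodule.quotEquivOfEq _ _ hker ≪≫ₗ
    p₂.quotKerEquivOfSurjective hp₂, fun v w hvw => ?_⟩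
  let q : G := ⟨(v, w), hvw⟩
  have h3 : (p₁.quotKerEquivOfSurjective hp₁).symm (Submodule.Quotient.mk v) =
      Submodule.Quotient.mk q := by
    rw [LinearEquiv.symm_apply_eq]
    rfl
  rw [LinearEquiv.trans_apply, LinearEquiv.trans_apply, h3]
  rfl

end Jet

theorem mainTheorem2 {n m r : ℕ} (L : Jet.LocalFn n m) (R : Fin r → Fin m → Jet.DiffOp n m)
    (hL : Jet.IsRegular L) (hR : Jet.IsIrreducibleGaugeTheory L R) :
    Jet.trivialSymmetries L R ≤ Jet.variationalSymmetries L ∧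
    Jet.trivialCurrents L ≤ Jet.conservedCurrents L ∧
    (∀ Q ∈ Jet.variationalSymmetries L, ∃ j ∈ Jet.conservedCurrents L,
      Jet.IsNoetherCurrent L Q j) ∧
    ∃ Φ : Jet.SymmetryClasses L R ≃ₗ[ℝ] Jet.CurrentClasses L,
      ∀ (Q : Jet.variationalSymmetries L) (j : Jet.conservedCurrents L),
        Jet.IsNoetherCurrent L Q.1 j.1 →
          Φ (Submodule.Quotient.mk Q) = Submodule.Quotient.mk j := by
  refine ⟨fun Q hQ => ?_, Jet.trivialCurrents_le hL, fun Q hQ => Jet.exists_isNoetherCurrent hQ, ?_⟩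
  · exact Jet.mem_variationalSymmetries_iff.2
      (Jet.divergences_mono le_top _ ((Jet.mem_trivialSymmetries_iff hL hR).1 hQ))
  refine Jet.exists_quotientEquiv_of_relation _ _ (Jet.noetherPairs L) (fun Q => ?_) (fun j => ?_)
    fun Q j h => Jet.mem_trivialSymmetries_iff_mem_trivialCurrents hL hR j.2 h
  · obtain ⟨j, hj, hQj⟩ := Jet.exists_isNoetherCurrent Q.2
    exact ⟨⟨j, hj⟩, hQj⟩
  · obtain ⟨Q, hQ, t, ht, hQj⟩ := Jet.exists_isNoetherCurrent_sub hL j.2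
    have ht' : Jet.current t ∈ Jet.trivialCurrents L :=
      ⟨Jet.current t, 0, 0, Jet.current_mem_degree t, Jet.weaklyZero_current ht, zero_mem _,
        fun _ => rfl, by simp [Jet.constForm]⟩
    refine ⟨⟨Q, hQ⟩, ⟨_, sub_mem j.2 (Jet.trivialCurrents_le hL ht')⟩, hQj, ?_⟩
    have h3 : j.1 - Jet.current t - j.1 ∈ Jet.trivialCurrents L := by
      rw [sub_sub_cancel_left]
      exact neg_mem ht'
    exact h3
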